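/- Let $n\ge 2$ and let $\mathbb S^n$ be the unit sphere of $\mathbb R^{n+1}$ with spherical distance $d(v,w)=\arccos(v\cdot w)$. Let $K\subseteq\mathbb S^n$ be a proper spherical convex body with non-empty interior, that is, $K$ is closed, $\{rv: r\ge 0,\ v\in K\}$ is convex, and $K$ contains no pair of antipodal points. Let $u\in\mathbb S^n$ be such that $K\subseteq\operatorname{int}\mathbb S_u^+=\{v\in\mathbb S^n: u\cdot v>0\}$, put $\mathbb S_u=\{v\in\mathbb S^n:u\cdot v=0\}$, and let $g_u(v)=\frac{v}{u\cdot v}-u$ be the gnomonic projection of $\operatorname{int}\mathbb S_u^+$ onto $\mathbb R^n_u=\{x\in\mathbb R^{n+1}:u\cdot x=0\}$. Then for $\mathcal H^{n-1}$-almost every $w\in\operatorname{bd}K$ the curvatures below exist and $$H_{n-1}^{\mathbb S^n}(K,w)=H_{n-1}^{\mathbb R^n}\bigl(g_u(K),g_u(w)\bigr)\left(\frac{\cos h_u\bigl(K,N_w^K|\mathbb S_u\bigr)}{\cos d(u,w)}\right)^{n+1}.$$ Here $\operatorname{bd}$ and $\operatorname{int}$ of $K$ are taken in $\mathbb S^n$.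 An outer unit normal of $K$ at $w\in\operatorname{bd}K$ is a unit vector $N$ with $N\cdot w=0$ and $N\cdot w'\le 0$ for all $w'\in K$, and $w$ is regular if there is exactly one, denoted $N_w^K$. The spherical Gauss–Kronecker curvature $H_{n-1}^{\mathbb S^n}(K,w)$ is the determinant of the differential at $w$ of the Gauss map $N^K: w'\mapsto N_{w'}^K$, defined on the regular boundary points, on the tangent space $T_w\operatorname{bd}K=\{w,N_w^K\}^\perp$; it exists if $w$ is regular and $N^K$ is differentiable at $w$. Likewise, for a convex body $L$ in $\mathbb R^n_u$, $H_{n-1}^{\mathbb R^n}(L,x)$ is the determinant of the differential at $x$ of the Euclidean Gauss map of $L$ on $T_x\operatorname{bd}L=\{y\in\mathbb R^n_u: y\cdot N_x^L=0\}$. For a great subsphere $S=U\cap\mathbb S^n$ with $U$ a linear subspace, $w|S$ is the normalized orthogonal projection of $w$ to $U$. Finally, for $v\in\mathbb S_u$, $$h_u(K,v)=\max\{\operatorname{sgn}(v\cdot w)\,d(u,w|\mathbb S^1_{u,v}): w\in K\}$$ is the spherical support function, where $\mathbb S^1_{u,v}$ is the great circle spanned by $u$ and $v$. -/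

import Mathlib

open Metric MeasureTheory
open scoped RealInnerProductSpace

noncomputable section

namespace SphericalConvex

/-! ### Euclidean convex bodies -/

section Euclidean

variable {F : Type*} [NormedAddCommGroup F] [InnerProductSpace ℝ F]

/-- `N` is an outer unit normal vector of the set `L` at the point `x`. -/
def IsOuterNormal (L : Set F) (x N : F) : Prop :=
  ‖N‖ = 1 ∧ ∀ y ∈ L, ⟪y - x, N⟫ ≤ 0

/-- The regular boundary points of `L`: those with exactly one outer unit normal. -/
def reg (L : Set F) : Set F :=
  {x | x ∈ frontier L ∧ ∃! N : F, IsOuterNormal L x N}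

/-- The Gauss map of `L`: the outer unit normal at a regular boundary point (its values at
other points are irrelevant). -/
def gaussMap (L : Set F) (x : F) : F :=
  Classical.epsilon (IsOuterNormal L x)

/-- The determinant of `A` regarded as an endomorphism of the subspace `T`. (When `A` maps `T`
into `T`, the orthogonal projection only restricts the codomain.) -/
def tangentialDet (T : Submodule ℝ F) [T.HasOrthogonalProjection] (A : F →L[ℝ] F) : ℝ :=
  LinearMap.det ((T.orthogonalProjectionOnto ∘L A ∘L T.subtypeL : T →L[ℝ] T) : T →ₗ[ℝ] T)

/-- The (generalized) Gauss-Kronecker curvature of `L` exists at `x`: the point is regular and the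
Gauss map, as a map on the regular boundary points, is differentiable there. -/
def CurvatureExistsAt (L : Set F) (x : F) : Prop :=
  x ∈ reg L ∧ DifferentiableWithinAt ℝ (gaussMap L) (reg L) x

/-- The (generalized) Gauss-Kronecker curvature of `L` at `x`: the determinant of the differential
of the Gauss map (the Weingarten map) on the tangent space `T_x bd L`, which is the orthogonal
complement of the outer unit normal. -/
def gaussKronecker (L : Set F) (x : F) : ℝ :=
  tangentialDet (ℝ ∙ gaussMap L x)ᗮ (fderivWithin ℝ (gaussMap L) (reg L) x)

/-- The spherical projection `w | S` of a point `w` of the unit sphere to the great subsphere `S`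
cut out by the linear subspace `U`: the normalized orthogonal projection of `w` to `U`.
For `U = v^⊥` this is `(w - cos (d (v, w)) v) / sin (d (v, w))`. -/
def sphericalProj (U : Submodule ℝ F) [U.HasOrthogonalProjection] (w : F) : F :=
  ‖U.starProjection w‖⁻¹ • U.starProjection w

/-- The natural distance on the unit sphere. -/
def sphericalDist (v w : F) : ℝ := Real.arccos ⟪v, w⟫

end Euclidean

/-! ### Spherical convex bodies -/

section Sphere

variable {E : Type*} [NormedAddCommGroup E] [InnerProductSpace ℝ E]

/-- The radial extension of a subset of the unit sphere. -/
def radialExtension (A : Set (sphere (0 : E) 1)) : Set E :=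
  {x | ∃ r : ℝ, 0 ≤ r ∧ ∃ v ∈ A, x = r • (v : E)}

/-- Spherical convex bodies that are proper, that is, contain no pair of antipodal points. -/
structure IsProperConvexBody (K : Set (sphere (0 : E) 1)) : Prop where
  isClosed : IsClosed K
  convex : Convex ℝ (radialExtension K)
  proper : ∀ v ∈ K, -v ∉ K

/-- The closed hemisphere with centre `u`. -/
def closedHemisphere (u : sphere (0 : E) 1) : Set (sphere (0 : E) 1) :=
  {v | 0 ≤ ⟪(u : E), (v : E)⟫}

/-- `N` is an outer unit normal of `K` at the point `w` of the sphere: it is a unit vector tangent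
to the sphere at `w`, and `K` lies in the closed hemisphere centred at `-N`. -/
def IsSphericalOuterNormal (K : Set (sphere (0 : E) 1)) (w N : E) : Prop :=
  ‖N‖ = 1 ∧ ⟪w, N⟫ = 0 ∧ ∀ y ∈ K, ⟪(y : E), N⟫ ≤ 0

/-- The regular boundary points of `K` (as points of the ambient space); the boundary is taken
in the sphere. -/
def sphericalReg (K : Set (sphere (0 : E) 1)) : Set E :=
  {x | ∃ w : sphere (0 : E) 1, (w : E) = x ∧ w ∈ frontier K ∧
    ∃! N : E, IsSphericalOuterNormal K x N}

/-- The spherical Gauss map `w ↦ N_w^K` (its values off the regular boundary points are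
irrelevant). -/
def sphericalGaussMap (K : Set (sphere (0 : E) 1)) (w : E) : E :=
  Classical.epsilon (IsSphericalOuterNormal K w)

/-- The spherical Gauss-Kronecker curvature of `K` exists at `w`: the point is regular and the
Gauss map, as a map on the regular boundary points, is differentiable there. -/
def SphericalCurvatureExistsAt (K : Set (sphere (0 : E) 1)) (w : E) : Prop :=
  w ∈ sphericalReg K ∧ DifferentiableWithinAt ℝ (sphericalGaussMap K) (sphericalReg K) w

/-- The spherical Gauss-Kronecker curvature of `K` at `w`: the determinant of the differential of
the spherical Gauss map on the tangent space `T_w bd K`, which is the orthogonal complement of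
`w` and the outer unit normal at `w`. -/
def sphericalGaussKronecker [FiniteDimensional ℝ E] (K : Set (sphere (0 : E) 1)) (w : E) : ℝ :=
  tangentialDet (Submodule.span ℝ {w, sphericalGaussMap K w})ᗮ
    (fderivWithin ℝ (sphericalGaussMap K) (sphericalReg K) w)

/-- The spherical support function `h_u(K, v)`, for `v` in the great subsphere orthogonal to `u`:
the largest value on `K` of the signed distance of `u` to the projection of a point to the great
circle spanned by `u` and `v`. (For a body in the open hemisphere the maximum is attained.) -/
def sphericalSupport [FiniteDimensional ℝ E] (u : sphere (0 : E) 1)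
    (K : Set (sphere (0 : E) 1)) (v : E) : ℝ :=
  sSup ((fun w : sphere (0 : E) 1 =>
    Real.sign ⟪v, (w : E)⟫ *
      sphericalDist (u : E) (sphericalProj (Submodule.span ℝ {(u : E), v}) (w : E))) '' K)

/-- The gnomonic projection `g_u(v) = v / (u · v) - u`. On the open hemisphere with centre `u` the
vector on the right is orthogonal to `u`, and the projection only restricts the codomain
(see `coe_gnomonic`). -/
def gnomonic (u v : sphere (0 : E) 1) : (ℝ ∙ (u : E))ᗮ :=
  (ℝ ∙ (u : E))ᗮ.orthogonalProjectionOnto ((⟪(u : E), (v : E)⟫)⁻¹ • (v : E) - (u : E))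

theorem coe_gnomonic (u v : sphere (0 : E) 1) (h : ⟪(u : E), (v : E)⟫ ≠ 0) :
    (gnomonic u v : E) = (⟪(u : E), (v : E)⟫)⁻¹ • (v : E) - (u : E) := by
  have hu : ‖(u : E)‖ = 1 := by simp
  have hm : (⟪(u : E), (v : E)⟫)⁻¹ • (v : E) - (u : E) ∈ (ℝ ∙ (u : E))ᗮ := by
    rw [Submodule.mem_orthogonal_singleton_iff_inner_right, inner_sub_right, inner_smul_right,
      real_inner_self_eq_norm_sq, hu, inv_mul_cancel₀ h]
    norm_num
  exact Submodule.starProjection_eq_self_iff.mpr hm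

end Sphere

end SphericalConvex

end

/-! Gnomonic projection turns K into a Euclidean convex body L in the hyperplane orthogonal to u,
and the argument has an analytic half and an algebraic half.

Existence is Aleksandrov's theorem for the Gauss map of L
(`hausdorffMeasure_not_regularCurvatureAt`). Put the origin inside L. On an affine hyperplane e +
e^⊥ the gauge of L is a convex Lipschitz function whose gradient encodes the outer normal. By
Rademacher the gradient exists almost everywhere; it is monotone, so by Mignot's theorem
(`ae_differentiableWithinAt_of_monotone`) it is itself differentiable almost everywhere. Lipschitz
central projections carry the exceptional sets to the boundary of L, and the Lipschitz inverse
gnomonic projection carries them on to the boundary of K.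

For the formula, write w = (u + x)/ρ with ρ = ‖u + x‖, and let N be the normal of L at x. The
spherical normal at w is M = (N - ⟨x,N⟩u)/c with c = √(1 + ⟨x,N⟩²). Differentiating this relation
and projecting to the tangent space {w, M}^⊥ makes the spherical Weingarten map conjugate to ρ/c
times a rank-one perturbation of the identity composed with the Euclidean one. On a space of
dimension n - 1 the scalar contributes (ρ/c)^(n-1) and the perturbation (ρ/c)^2
(`tangentialDet_span_pair_eq`). Finally 1/ρ = cos d(u,w), while h_u is the arctangent of the
Euclidean support function, so that 1/c = cos h_u (`sphericalSupport_eq_arctan`).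

The Gauss maps live only on the regular points, where a derivative within the set is determined only
along tangent directions. `RegularCurvatureAt` therefore also records that the regular points are
tangentially full. -/

noncomputable section

namespace SphericalConvex

/-! ### Differentiability almost everywhere of monotone maps. -/

section Monotone

open Measure Module Filter Topology

variable {W : Type*} [NormedAddCommGroup W] [InnerProductSpace ℝ W] [FiniteDimensional ℝ W]
  [MeasurableSpace W] [BorelSpace W]

/-- Mignot's theorem for single-valued operators: a continuous monotone map on an arbitrary subset
of a Euclidean space is differentiable almost everywhere within that set. -/
theorem ae_differentiableWithinAt_of_monotone {R : Set W} {T : W → W}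
    (hT : ∀ x ∈ R, ∀ y ∈ R, 0 ≤ ⟪T x - T y, x - y⟫) (hc : ContinuousOn T R) :
    ∀ᵐ y ∂(μH[finrank ℝ W] : Measure W), y ∈ R → DifferentiableWithinAt ℝ T R y := by
  -- Minty's trick: id + T is expansive, so its inverse J, the resolvent, is 1-Lipschitz and
  -- Rademacher's theorem applies to J.
  set a : W → W := fun x => x + T x with ha
  have hexp : ∀ x ∈ R, ∀ y ∈ R, ‖x - y‖ ≤ ‖a x - a y‖ := by
    intro x hx y hy
    have h1 : a x - a y = (x - y) + (T x - T y) := by simp only [ha]; abel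
    have h2 := norm_add_sq_real (x - y) (T x - T y)
    have h3 := hT x hx y hy
    rw [real_inner_comm] at h3
    rw [h1]
    apply le_of_sq_le_sq _ (norm_nonneg _)
    nlinarith [sq_nonneg ‖T x - T y‖]
  have hinj : Set.InjOn a R := by
    intro x hx y hy hxy
    have := hexp x hx y hy
    rw [hxy, sub_self, norm_zero] at this
    exact sub_eq_zero.1 (norm_le_zero_iff.1 this)
  set J : W → W := Function.invFunOn a R with hJ
  have hJa : ∀ x ∈ R, J (a x) = x := fun x hx => hinj.leftInvOn_invFunOn hx
  have hJL : LipschitzOnWith 1 J (a '' R) := by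
    apply LipschitzOnWith.of_dist_le_mul
    rintro _ ⟨x, hx, rfl⟩ _ ⟨y, hy, rfl⟩
    rw [hJa x hx, hJa y hy, dist_eq_norm, dist_eq_norm]
    simpa using hexp x hx y hy
  have hca : ContinuousOn a R := continuousOn_id.add hc
  set Z₁ : Set W := {z | z ∈ a '' R ∧ ¬ DifferentiableWithinAt ℝ J (a '' R) z} with hZ₁
  set Z₂ : Set W := {z | z ∈ a '' R ∧ DifferentiableWithinAt ℝ J (a '' R) z ∧
    (fderivWithin ℝ J (a '' R) z).det = 0} with hZ₂
  have h₁ : (μH[finrank ℝ W] : Measure W) (J '' Z₁) = 0 := by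
    have h0 : (μH[finrank ℝ W] : Measure W) Z₁ = 0 := by
      have := hJL.ae_differentiableWithinAt_of_mem (μ := (μH[finrank ℝ W] : Measure W))
      rw [ae_iff] at this
      simpa only [hZ₁, Classical.not_imp] using this
    have := (hJL.mono (fun z hz => hz.1 : Z₁ ⊆ a '' R)).hausdorffMeasure_image_le
      (d := finrank ℝ W) (by positivity)
    rw [h0, mul_zero] at this
    exact le_antisymm this (zero_le)
  -- Sard's lemma: the image of the points where the derivative of J is singular is null.
  have h₂ : (μH[finrank ℝ W] : Measure W) (J '' Z₂) = 0 := by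
    apply addHaar_image_eq_zero_of_det_fderivWithin_eq_zero (f' := fderivWithin ℝ J (a '' R))
    · intro z hz
      exact hz.2.1.hasFDerivWithinAt.mono (fun z hz => hz.1)
    · intro z hz
      exact hz.2.2
  have h₃ : ∀ᵐ y ∂(μH[finrank ℝ W] : Measure W), y ∉ J '' Z₁ ∪ J '' Z₂ := by
    exact measure_eq_zero_iff_ae_notMem.1 (measure_union_null h₁ h₂)
  filter_upwards [h₃] with y hy hyR
  rw [Set.mem_union, not_or] at hy
  have hd : DifferentiableWithinAt ℝ J (a '' R) (a y) := by
    by_contra h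
    exact hy.1 ⟨a y, ⟨Set.mem_image_of_mem a hyR, h⟩, hJa y hyR⟩
  have hdet : (fderivWithin ℝ J (a '' R) (a y)).det ≠ 0 := by
    intro h
    exact hy.2 ⟨a y, ⟨Set.mem_image_of_mem a hyR, hd, h⟩, hJa y hyR⟩
  have hA := hd.hasFDerivWithinAt
  rw [← ContinuousLinearMap.coe_toContinuousLinearEquivOfDetNeZero _ hdet] at hA
  -- Where the derivative of J is invertible, its continuous inverse a is differentiable, hence so
  -- is T = a - id.
  have hinv := HasFDerivWithinAt.of_local_left_inverse (g := a) (s := R) (a := y)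
    (tendsto_nhdsWithin_iff.2 ⟨hca y hyR, eventually_mem_nhdsWithin.mono
      fun x hx => Set.mem_image_of_mem a hx⟩) hA hyR
    (eventually_mem_nhdsWithin.mono fun x hx => hJa x hx)
  have := hinv.differentiableWithinAt.sub (differentiableWithinAt_id (𝕜 := ℝ) (s := R) (x := y))
  refine this.congr (fun x _ => ?_) ?_ <;> simp [ha]

end Monotone

/-! ### Outer normals, the gauge and central charts of the boundary. -/

section ConvexBody

open Measure Module Filter Topology

variable {F : Type*} [NormedAddCommGroup F] [InnerProductSpace ℝ F] {L : Set F}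

theorem isOuterNormal_gaussMap {x : F} (hx : x ∈ reg L) : IsOuterNormal L x (gaussMap L x) :=
  Classical.epsilon_spec hx.2.exists

theorem gaussMap_eq {x N : F} (hx : x ∈ reg L) (hN : IsOuterNormal L x N) : gaussMap L x = N :=
  hx.2.unique (isOuterNormal_gaussMap hx) hN

theorem norm_gaussMap {x : F} (hx : x ∈ reg L) : ‖gaussMap L x‖ = 1 :=
  (isOuterNormal_gaussMap hx).1

/-- Being an outer normal is a closed condition, so every cluster point of nearby normals is a
normal at x. Compactness of the unit sphere and uniqueness at x do the rest. -/
theorem continuousOn_gaussMap [FiniteDimensional ℝ F] : ContinuousOn (gaussMap L) (reg L) := by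
  intro x hx
  refine (isCompact_sphere (0 : F) 1).tendsto_nhds_of_unique_mapClusterPt ?_ ?_
  · filter_upwards [self_mem_nhdsWithin] with z hz
    simpa using norm_gaussMap hz
  · intro M hM hcl
    obtain ⟨U, hU, hlim⟩ := mapClusterPt_iff_ultrafilter.1 hcl
    have hx' : Tendsto (fun z : F => z) U (𝓝 x) :=
      (tendsto_id'.2 hU).trans nhdsWithin_le_nhds
    refine (gaussMap_eq hx ⟨by simpa using hM, fun y hy => ?_⟩).symm
    refine le_of_tendsto ((tendsto_const_nhds.sub hx').inner hlim) ?_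
    filter_upwards [hU self_mem_nhdsWithin] with z hz
    exact (isOuterNormal_gaussMap hz).2 y hy

/-- Every boundary point of a convex set with non-empty interior has an outer unit normal. -/
theorem exists_isOuterNormal [CompleteSpace F] (hL : Convex ℝ L) (hi : (interior L).Nonempty)
    {x : F} (hx : x ∈ frontier L) : ∃ N, IsOuterNormal L x N := by
  obtain ⟨f, hf⟩ := geometric_hahn_banach_open_point hL.interior isOpen_interior hx.2
  set v := (InnerProductSpace.toDual ℝ F).symm f with hv
  have hvf : ∀ z, f z = ⟪z, v⟫ := fun z => by
    rw [real_inner_comm, hv, InnerProductSpace.toDual_symm_apply]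
  obtain ⟨c, hc⟩ := hi
  have hv0 : v ≠ 0 := by
    intro h
    have := hf c hc
    simp [hvf, h] at this
  refine ⟨‖v‖⁻¹ • v, norm_smul_inv_norm (𝕜 := ℝ) hv0, fun y hy => ?_⟩
  have hy' : y ∈ closure (interior L) := by
    rw [hL.closure_interior_eq_closure_of_nonempty_interior ⟨c, hc⟩]
    exact subset_closure hy
  have h : ⟪y, v⟫ ≤ ⟪x, v⟫ := by
    have hcl : IsClosed {z : F | ⟪z, v⟫ ≤ ⟪x, v⟫} :=
      isClosed_le (by fun_prop) continuous_const
    refine closure_minimal (fun z hz => ?_) hcl hy'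
    have := hf z hz
    rw [hvf, hvf] at this
    exact this.le
  rw [inner_smul_right, inner_sub_left]
  exact mul_nonpos_of_nonneg_of_nonpos (by positivity) (by linarith)

theorem inner_pos_of_isOuterNormal (h0 : L ∈ 𝓝 (0 : F)) {x N : F} (hN : IsOuterNormal L x N) :
    0 < ⟪x, N⟫ := by
  obtain ⟨ε, hε, hb⟩ := Metric.mem_nhds_iff.1 h0
  have := hN.2 ((ε / 2) • N) (hb (by simp [norm_smul, hN.1, abs_of_pos hε]; linarith))
  rw [inner_sub_left, inner_smul_left, real_inner_self_eq_norm_sq, hN.1] at this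
  simp at this
  linarith

/-- The normalization of an outer normal vector `N` at `x` that lies on the polar body. -/
def polarVector (x N : F) : F := (⟪x, N⟫)⁻¹ • N

theorem inner_polarVector_self (h0 : L ∈ 𝓝 (0 : F)) {x N : F} (hN : IsOuterNormal L x N) :
    ⟪x, polarVector x N⟫ = 1 := by
  rw [polarVector, inner_smul_right, inv_mul_cancel₀ (inner_pos_of_isOuterNormal h0 hN).ne']

theorem normalize_polarVector (h0 : L ∈ 𝓝 (0 : F)) {x N : F} (hN : IsOuterNormal L x N) :
    ‖polarVector x N‖⁻¹ • polarVector x N = N := by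
  have := inner_pos_of_isOuterNormal h0 hN
  rw [polarVector, norm_smul, hN.1, Real.norm_of_nonneg (by positivity), smul_smul]
  simp [this.ne']

theorem gauge_pos_of_ne (h0 : L ∈ 𝓝 (0 : F)) (hb : Bornology.IsBounded L) {z : F} (hz : z ≠ 0) :
    0 < gauge L z :=
  (gauge_pos (absorbent_nhds_zero h0) (NormedSpace.isVonNBounded_of_isBounded _ hb)).2 hz

theorem inv_gauge_smul_mem_frontier (hL : Convex ℝ L) (h0 : L ∈ 𝓝 (0 : F))
    (hb : Bornology.IsBounded L) {z : F} (hz : z ≠ 0) : (gauge L z)⁻¹ • z ∈ frontier L := by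
  have hg := gauge_pos_of_ne h0 hb hz
  rw [← gauge_eq_one_iff_mem_frontier hL h0, gauge_smul_of_nonneg (by positivity), smul_eq_mul,
    inv_mul_cancel₀ hg.ne']

/-- The polar vector is a subgradient of the gauge at x: the linear function lies below the gauge
and touches it along the ray through x. -/
theorem inner_polarVector_le (hL : Convex ℝ L) (hc : IsClosed L) (h0 : L ∈ 𝓝 (0 : F))
    (hb : Bornology.IsBounded L) {x N : F} (hN : IsOuterNormal L x N) (z : F) :
    ⟪z, polarVector x N⟫ ≤ gauge L z := by
  rcases eq_or_ne z 0 with rfl | hz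
  · simp
  have hg := gauge_pos_of_ne h0 hb hz
  have hpos := inner_pos_of_isOuterNormal h0 hN
  have h := hN.2 _ (hc.frontier_subset (inv_gauge_smul_mem_frontier hL h0 hb hz))
  rw [inner_sub_left, inner_smul_left] at h
  simp only [conj_trivial] at h
  rw [polarVector, inner_smul_right]
  rw [inv_mul_le_iff₀ hpos]
  rw [sub_nonpos, inv_mul_le_iff₀ hg] at h
  linarith

/-- The central projection of the affine hyperplane `e + e^⊥` to the boundary of `L`. -/
def boundaryChart (L : Set F) (e : F) (y : (ℝ ∙ e)ᗮ) : F :=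
  (gauge L (e + (y : F)))⁻¹ • (e + (y : F))

/-- The inverse of `boundaryChart`. -/
def boundaryCoord (e x : F) : (ℝ ∙ e)ᗮ :=
  (ℝ ∙ e)ᗮ.orthogonalProjectionOnto ((⟪x, e⟫)⁻¹ • x)

variable {e : F}

theorem inner_coe_orthogonal (y : (ℝ ∙ e)ᗮ) : ⟪(y : F), e⟫ = 0 :=
  Submodule.mem_orthogonal_singleton_iff_inner_left.1 y.2

theorem inner_add_orthogonal (he : ‖e‖ = 1) (y : (ℝ ∙ e)ᗮ) : ⟪e + (y : F), e⟫ = 1 := by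
  rw [inner_add_left, inner_coe_orthogonal, real_inner_self_eq_norm_sq, he]
  norm_num

theorem add_orthogonal_ne_zero (he : ‖e‖ = 1) (y : (ℝ ∙ e)ᗮ) : e + (y : F) ≠ 0 := by
  intro h
  have := inner_add_orthogonal he y
  rw [h, inner_zero_left] at this
  exact zero_ne_one this

theorem coe_boundaryCoord (he : ‖e‖ = 1) {x : F} (hx : ⟪x, e⟫ ≠ 0) :
    (boundaryCoord e x : F) = (⟪x, e⟫)⁻¹ • x - e := by
  refine Submodule.eq_starProjection_of_mem_orthogonal ?_ ?_
  · rw [Submodule.mem_orthogonal_singleton_iff_inner_left, inner_sub_left, inner_smul_left,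
      real_inner_self_eq_norm_sq, he]
    simp [hx]
  · rw [sub_sub_cancel]
    exact (ℝ ∙ e).le_orthogonal_orthogonal (Submodule.mem_span_singleton_self e)

theorem boundaryChart_boundaryCoord (hL : Convex ℝ L) (h0 : L ∈ 𝓝 (0 : F)) (he : ‖e‖ = 1)
    {x : F} (hx : x ∈ frontier L) (hpos : 0 < ⟪x, e⟫) :
    boundaryChart L e (boundaryCoord e x) = x := by
  rw [boundaryChart, coe_boundaryCoord he hpos.ne', add_sub_cancel,
    gauge_smul_of_nonneg (by positivity), (gauge_eq_one_iff_mem_frontier hL h0).2 hx, smul_smul]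
  simp [hpos.ne']

theorem inner_boundaryChart_pos (h0 : L ∈ 𝓝 (0 : F)) (hb : Bornology.IsBounded L)
    (he : ‖e‖ = 1) (y : (ℝ ∙ e)ᗮ) : 0 < ⟪boundaryChart L e y, e⟫ := by
  have := gauge_pos_of_ne h0 hb (add_orthogonal_ne_zero he y)
  rw [boundaryChart, inner_smul_left, inner_add_orthogonal he]
  simpa using this

theorem boundaryCoord_boundaryChart (h0 : L ∈ 𝓝 (0 : F)) (hb : Bornology.IsBounded L)
    (he : ‖e‖ = 1) (y : (ℝ ∙ e)ᗮ) : boundaryCoord e (boundaryChart L e y) = y := by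
  have hg := gauge_pos_of_ne h0 hb (add_orthogonal_ne_zero he y)
  apply Subtype.ext
  rw [coe_boundaryCoord he (inner_boundaryChart_pos h0 hb he y).ne', boundaryChart,
    inner_smul_left, inner_add_orthogonal he, smul_smul]
  simp [hg.ne']

theorem boundaryChart_mem_frontier (hL : Convex ℝ L) (h0 : L ∈ 𝓝 (0 : F))
    (hb : Bornology.IsBounded L) (he : ‖e‖ = 1) (y : (ℝ ∙ e)ᗮ) :
    boundaryChart L e y ∈ frontier L :=
  inv_gauge_smul_mem_frontier hL h0 hb (add_orthogonal_ne_zero he y)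

/-- The gauge is Lipschitz and at least ‖z‖/r when L lies in the ball of radius r. Since ‖e + y‖ ≥
1, it stays away from 0 on the affine hyperplane, so dividing by it is harmless. -/
theorem exists_lipschitzWith_boundaryChart (hL : Convex ℝ L) (h0 : L ∈ 𝓝 (0 : F))
    (hb : Bornology.IsBounded L) (he : ‖e‖ = 1) : ∃ C, LipschitzWith C (boundaryChart L e) := by
  obtain ⟨C, hC⟩ := hL.lipschitz_gauge h0
  obtain ⟨r, hr, hr'⟩ := hb.exists_pos_norm_le
  have hlow : ∀ z : F, ‖z‖ ≤ r * gauge L z := by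
    intro z
    rcases eq_or_ne z 0 with rfl | hz
    · simp
    have := le_gauge_of_subset_closedBall (absorbent_nhds_zero h0) hr.le
      (fun z hz => by simpa using hr' z hz) (x := z)
    rwa [div_le_iff₀' hr] at this
  have hn : ∀ y : (ℝ ∙ e)ᗮ, 1 ≤ ‖e + (y : F)‖ := by
    intro y
    have := real_inner_le_norm (e + (y : F)) e
    rwa [inner_add_orthogonal he, he, mul_one] at this
  refine ⟨⟨r + C * r ^ 2, by positivity⟩, LipschitzWith.of_dist_le_mul fun y y' => ?_⟩
  set z := e + (y : F) with hz
  set z' := e + (y' : F) with hz'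
  have hzz : ‖z - z'‖ = dist y y' := by
    rw [hz, hz', add_sub_add_left_eq_sub, dist_eq_norm]; rfl
  have hg := gauge_pos_of_ne h0 hb (add_orthogonal_ne_zero he y)
  have hg' := gauge_pos_of_ne h0 hb (add_orthogonal_ne_zero he y')
  rw [← hz] at hg
  rw [← hz'] at hg'
  have key : boundaryChart L e y - boundaryChart L e y' = (gauge L z)⁻¹ • (z - z')
      + ((gauge L z)⁻¹ * (gauge L z')⁻¹ * (gauge L z' - gauge L z)) • z' := by
    have : (gauge L z)⁻¹ * (gauge L z')⁻¹ * (gauge L z' - gauge L z)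
        = (gauge L z)⁻¹ - (gauge L z')⁻¹ := by field_simp
    rw [this, boundaryChart, boundaryChart, ← hz, ← hz']
    module
  have hi : (gauge L z)⁻¹ ≤ r := by
    rw [inv_le_comm₀ hg hr, inv_le_iff_one_le_mul₀' hr]
    exact (hn y).trans (hlow z)
  have hi' : (gauge L z')⁻¹ * ‖z'‖ ≤ r := by
    rw [inv_mul_le_iff₀ hg', mul_comm]; exact hlow z'
  have hd : |gauge L z' - gauge L z| ≤ C * ‖z - z'‖ := by
    have := hC.dist_le_mul z' z
    rwa [Real.dist_eq, dist_eq_norm, norm_sub_rev z'] at this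
  rw [dist_eq_norm, key, ← hzz]
  refine (norm_add_le _ _).trans ?_
  rw [norm_smul, norm_smul, norm_mul, norm_mul, norm_inv, norm_inv, Real.norm_of_nonneg hg.le,
    Real.norm_of_nonneg hg'.le, Real.norm_eq_abs]
  calc _ = (gauge L z)⁻¹ * ‖z - z'‖ +
        (gauge L z)⁻¹ * ((gauge L z')⁻¹ * ‖z'‖) * |gauge L z' - gauge L z| := by ring
    _ ≤ r * ‖z - z'‖ + r * r * (C * ‖z - z'‖) := by gcongr
    _ = (r + C * r ^ 2) * ‖z - z'‖ := by ring

theorem inner_gaussMap_polar_eq (h0 : L ∈ 𝓝 (0 : F)) (hb : Bornology.IsBounded L)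
    (he : ‖e‖ = 1) (y : (ℝ ∙ e)ᗮ) {N : F} (hN : IsOuterNormal L (boundaryChart L e y) N) :
    ⟪e + (y : F), polarVector (boundaryChart L e y) N⟫ = gauge L (e + (y : F)) := by
  have hg := gauge_pos_of_ne h0 hb (add_orthogonal_ne_zero he y)
  have h := inner_polarVector_self h0 hN
  nth_rw 1 [boundaryChart] at h
  rw [inner_smul_left] at h
  simp only [conj_trivial] at h
  rwa [inv_mul_eq_iff_eq_mul₀ hg.ne', mul_one] at h

/-- The gauge minus the linear function of the polar vector is minimal at y, so its derivative
vanishes there. -/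
theorem fderiv_gauge_eq_inner_polarVector (hL : Convex ℝ L) (hc : IsClosed L)
    (h0 : L ∈ 𝓝 (0 : F)) (hb : Bornology.IsBounded L) (he : ‖e‖ = 1) {y : (ℝ ∙ e)ᗮ}
    {f' : (ℝ ∙ e)ᗮ →L[ℝ] ℝ}
    (hf : HasFDerivAt (fun y : (ℝ ∙ e)ᗮ => gauge L (e + (y : F))) f' y) {N : F}
    (hN : IsOuterNormal L (boundaryChart L e y) N) (ξ : (ℝ ∙ e)ᗮ) :
    f' ξ = ⟪(ξ : F), polarVector (boundaryChart L e y) N⟫ := by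
  set P := polarVector (boundaryChart L e y) N with hP
  have h1 : HasFDerivAt (fun y : (ℝ ∙ e)ᗮ => ⟪e + (y : F), P⟫)
      ((innerSL ℝ P) ∘L (ℝ ∙ e)ᗮ.subtypeL) y := by
    have h2 : HasFDerivAt (fun y : (ℝ ∙ e)ᗮ => ⟪e, P⟫ + ((innerSL ℝ P) ∘L (ℝ ∙ e)ᗮ.subtypeL) y)
      ((innerSL ℝ P) ∘L (ℝ ∙ e)ᗮ.subtypeL) y := (ContinuousLinearMap.hasFDerivAt _).const_add _
    refine h2.congr_of_eventuallyEq (Eventually.of_forall fun z => ?_)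
    simp [inner_add_left, real_inner_comm]
  have hmin : IsLocalMin (fun y : (ℝ ∙ e)ᗮ => gauge L (e + (y : F)) - ⟪e + (y : F), P⟫) y := by
    refine Eventually.of_forall fun z => ?_
    have h3 := inner_polarVector_le hL hc h0 hb hN (e + (z : F))
    have h4 := inner_gaussMap_polar_eq h0 hb he y hN
    simp only [← hP] at h3 h4 ⊢
    linarith
  have h5 := hmin.hasFDerivAt_eq_zero (hf.sub h1)
  have h6 := DFunLike.congr_fun h5 ξ
  simp only [_root_.sub_apply, _root_.zero_apply] at h6
  rw [sub_eq_zero.1 h6]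
  simp [real_inner_comm]

theorem eq_of_inner_orthogonal {P P' : F} (y : (ℝ ∙ e)ᗮ)
    (h : ∀ ξ : (ℝ ∙ e)ᗮ, ⟪(ξ : F), P⟫ = ⟪(ξ : F), P'⟫) (hy : ⟪e + (y : F), P⟫ = ⟪e + (y : F), P'⟫) :
    P = P' := by
  refine ext_inner_left ℝ fun z => ?_
  have he : ⟪e, P⟫ = ⟪e, P'⟫ := by
    rw [inner_add_left, inner_add_left, h y] at hy
    linarith
  obtain ⟨a, ha, b, hb, rfl⟩ := (ℝ ∙ e).exists_add_mem_mem_orthogonal z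
  obtain ⟨c, rfl⟩ := Submodule.mem_span_singleton.1 ha
  rw [inner_add_left, inner_add_left, inner_smul_left, inner_smul_left, he, h ⟨b, hb⟩]

/-- The derivative of the gauge fixes the polar vector along e^⊥, and its product with e + y fixes
the remaining component. Normalizing recovers the normal, which is therefore unique. -/
theorem boundaryChart_mem_reg [CompleteSpace F] (hL : Convex ℝ L) (hc : IsClosed L)
    (h0 : L ∈ 𝓝 (0 : F)) (hb : Bornology.IsBounded L) (he : ‖e‖ = 1) {y : (ℝ ∙ e)ᗮ}
    (hf : DifferentiableAt ℝ (fun y : (ℝ ∙ e)ᗮ => gauge L (e + (y : F))) y) :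
    boundaryChart L e y ∈ reg L := by
  have hx := boundaryChart_mem_frontier hL h0 hb he y
  refine ⟨hx, existsUnique_of_exists_of_unique
    (exists_isOuterNormal hL ⟨0, mem_interior_iff_mem_nhds.2 h0⟩ hx) fun N N' hN hN' => ?_⟩
  rw [← normalize_polarVector h0 hN, ← normalize_polarVector h0 hN']
  have : polarVector (boundaryChart L e y) N = polarVector (boundaryChart L e y) N' := by
    refine eq_of_inner_orthogonal y (fun ξ => ?_) ?_
    · rw [← fderiv_gauge_eq_inner_polarVector hL hc h0 hb he hf.hasFDerivAt hN,
        ← fderiv_gauge_eq_inner_polarVector hL hc h0 hb he hf.hasFDerivAt hN']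
    · rw [inner_gaussMap_polar_eq h0 hb he y hN, inner_gaussMap_polar_eq h0 hb he y hN']
  rw [this]

end ConvexBody

/-! ### Aleksandrov's theorem with the origin in the interior. -/

section Curvature

open Measure Module Filter Topology

variable {F : Type*} [NormedAddCommGroup F] [InnerProductSpace ℝ F]
  {L : Set F} {e : F}

/-- The gradient of `y ↦ gauge L (e + y)`, expressed by means of the Gauss map. -/
def gaugeGradient (L : Set F) (e : F) (y : (ℝ ∙ e)ᗮ) : (ℝ ∙ e)ᗮ :=
  (ℝ ∙ e)ᗮ.orthogonalProjectionOnto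
    (polarVector (boundaryChart L e y) (gaussMap L (boundaryChart L e y)))

theorem continuous_boundaryChart (hL : Convex ℝ L) (h0 : L ∈ 𝓝 (0 : F))
    (hb : Bornology.IsBounded L) (he : ‖e‖ = 1) : Continuous (boundaryChart L e) :=
  (exists_lipschitzWith_boundaryChart hL h0 hb he).choose_spec.continuous

/-- Monotonicity of subgradients: add the two subgradient inequalities at y and y'. -/
theorem inner_gaugeGradient_sub_nonneg (hL : Convex ℝ L) (hc : IsClosed L) (h0 : L ∈ 𝓝 (0 : F))
    (hb : Bornology.IsBounded L) (he : ‖e‖ = 1) {y y' : (ℝ ∙ e)ᗮ}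
    (hy : boundaryChart L e y ∈ reg L) (hy' : boundaryChart L e y' ∈ reg L) :
    0 ≤ ⟪gaugeGradient L e y - gaugeGradient L e y', y - y'⟫ := by
  have h1 := inner_gaussMap_polar_eq h0 hb he y (isOuterNormal_gaussMap hy)
  have h2 := inner_gaussMap_polar_eq h0 hb he y' (isOuterNormal_gaussMap hy')
  have h3 := inner_polarVector_le hL hc h0 hb (isOuterNormal_gaussMap hy) (e + (y' : F))
  have h4 := inner_polarVector_le hL hc h0 hb (isOuterNormal_gaussMap hy') (e + (y : F))
  rw [gaugeGradient, gaugeGradient, ← map_sub,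
    Submodule.inner_orthogonalProjectionOnto_eq_of_mem_right, real_inner_comm, Submodule.coe_sub]
  rw [inner_add_left] at h1 h2 h3 h4
  rw [inner_sub_left, inner_sub_right, inner_sub_right]
  linarith

/-- The normalization ⟨x,P⟩ = 1 determines the e-component of the polar vector P from its projection
to e^⊥. Differentiability of the gradient thus passes to P, and to the Gauss map after normalizing.
-/
theorem polarVector_eq_gaugeGradient (hL : Convex ℝ L) (h0 : L ∈ 𝓝 (0 : F)) (he : ‖e‖ = 1)
    {x : F} (hx : x ∈ reg L) (hpos : 0 < ⟪x, e⟫) :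
    polarVector x (gaussMap L x) = (gaugeGradient L e (boundaryCoord e x) : F) +
      ((⟪x, e⟫)⁻¹ - ⟪(gaugeGradient L e (boundaryCoord e x) : F), (boundaryCoord e x : F)⟫) • e := by
  have hch := boundaryChart_boundaryCoord hL h0 he hx.1 hpos
  have h1 := inner_polarVector_self h0 (isOuterNormal_gaussMap hx)
  set P := polarVector x (gaussMap L x) with hP
  have hG : gaugeGradient L e (boundaryCoord e x) = (ℝ ∙ e)ᗮ.orthogonalProjectionOnto P := by
    rw [gaugeGradient, hch]
  rw [← Submodule.coe_inner, hG, Submodule.inner_orthogonalProjectionOnto_eq_of_mem_right]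
  have h2 : ⟪P, (boundaryCoord e x : F)⟫ = (⟪x, e⟫)⁻¹ - ⟪P, e⟫ := by
    rw [coe_boundaryCoord he hpos.ne', inner_sub_right, inner_smul_right, real_inner_comm x P,
      h1, mul_one]
  rw [h2, sub_sub_cancel]
  have h3 := (ℝ ∙ e).starProjection_add_starProjection_orthogonal P
  rw [Submodule.starProjection_unit_singleton ℝ he, real_inner_comm] at h3
  nth_rw 1 [← h3]
  rw [add_comm]
  rfl

theorem hasFDerivAt_boundaryChart {y : (ℝ ∙ e)ᗮ} {f' : (ℝ ∙ e)ᗮ →L[ℝ] ℝ}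
    (hf : HasFDerivAt (fun y : (ℝ ∙ e)ᗮ => gauge L (e + (y : F))) f' y)
    (hg : gauge L (e + (y : F)) ≠ 0) :
    ∃ B : (ℝ ∙ e)ᗮ →L[ℝ] F, HasFDerivAt (boundaryChart L e) B y ∧ ∀ ξ, B ξ =
      (gauge L (e + (y : F)))⁻¹ • (ξ : F) -
        ((gauge L (e + (y : F)) ^ 2)⁻¹ * f' ξ) • (e + (y : F)) := by
  have h1 : HasFDerivAt (fun y : (ℝ ∙ e)ᗮ => e + (y : F)) (ℝ ∙ e)ᗮ.subtypeL y :=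
    ((ℝ ∙ e)ᗮ.subtypeL.hasFDerivAt).const_add e
  have h2 := (hasDerivAt_inv hg).comp_hasFDerivAt y hf
  refine ⟨_, h2.smul h1, fun ξ => ?_⟩
  simp [sub_eq_add_neg, add_comm]

theorem differentiableWithinAt_gaussMap (hL : Convex ℝ L) (h0 : L ∈ 𝓝 (0 : F))
    (hb : Bornology.IsBounded L) (he : ‖e‖ = 1) {y : (ℝ ∙ e)ᗮ}
    (hy : boundaryChart L e y ∈ reg L)
    (hT : DifferentiableWithinAt ℝ (gaugeGradient L e) (boundaryChart L e ⁻¹' reg L) y) :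
    DifferentiableWithinAt ℝ (gaussMap L) (reg L) (boundaryChart L e y) := by
  set x := boundaryChart L e y with hx
  have hpos : 0 < ⟪x, e⟫ := inner_boundaryChart_pos h0 hb he y
  have hopen : {z : F | 0 < ⟪z, e⟫} ∈ 𝓝 x :=
    (isOpen_lt continuous_const (by fun_prop)).mem_nhds hpos
  rw [← differentiableWithinAt_inter hopen]
  have hinner : DifferentiableWithinAt ℝ (fun z : F => (⟪z, e⟫)⁻¹) (reg L ∩ {z | 0 < ⟪z, e⟫}) x :=
    ((differentiableAt_id.inner ℝ (differentiableAt_const e)).inv hpos.ne').differentiableWithinAt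
  have hcoord : DifferentiableWithinAt ℝ (boundaryCoord e) (reg L ∩ {z | 0 < ⟪z, e⟫}) x :=
    ((ℝ ∙ e)ᗮ.orthogonalProjectionOnto).differentiableAt.comp_differentiableWithinAt x
      (hinner.smul differentiableWithinAt_id)
  have hyx : boundaryCoord e x = y := boundaryCoord_boundaryChart h0 hb he y
  have hTx : DifferentiableWithinAt ℝ (fun z => gaugeGradient L e (boundaryCoord e z))
      (reg L ∩ {z | 0 < ⟪z, e⟫}) x := by
    rw [← hyx] at hT
    refine hT.comp x hcoord fun z hz => ?_
    rw [Set.mem_preimage, boundaryChart_boundaryCoord hL h0 he hz.1.1 hz.2]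
    exact hz.1
  have hTx' := (ℝ ∙ e)ᗮ.subtypeL.differentiableAt.comp_differentiableWithinAt x hTx
  have hcoord' := (ℝ ∙ e)ᗮ.subtypeL.differentiableAt.comp_differentiableWithinAt x hcoord
  have hP := hTx'.add ((hinner.sub (hTx'.inner ℝ hcoord')).smul_const e)
  have hPeq := fun z (hz : z ∈ reg L ∩ {z | 0 < ⟪z, e⟫}) =>
    polarVector_eq_gaugeGradient hL h0 he hz.1 hz.2
  have hP' : DifferentiableWithinAt ℝ (fun z => polarVector z (gaussMap L z))
      (reg L ∩ {z | 0 < ⟪z, e⟫}) x := hP.congr hPeq (hPeq x ⟨hy, hpos⟩)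
  have hP0 : polarVector x (gaussMap L x) ≠ 0 := by
    intro h
    have := inner_polarVector_self h0 (isOuterNormal_gaussMap hy)
    rw [h, inner_zero_right] at this
    exact zero_ne_one this
  have := ((hP'.norm ℝ hP0).inv (norm_ne_zero_iff.2 hP0)).smul hP'
  refine this.congr (fun z hz => ?_) ?_
  · exact (normalize_polarVector h0 (isOuterNormal_gaussMap hz.1)).symm
  · exact (normalize_polarVector h0 (isOuterNormal_gaussMap hy)).symm

variable [FiniteDimensional ℝ F]

theorem continuousOn_gaugeGradient (hL : Convex ℝ L) (h0 : L ∈ 𝓝 (0 : F))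
    (hb : Bornology.IsBounded L) (he : ‖e‖ = 1) :
    ContinuousOn (gaugeGradient L e) (boundaryChart L e ⁻¹' reg L) := by
  have h1 := (continuous_boundaryChart hL h0 hb he).continuousOn
    (s := boundaryChart L e ⁻¹' reg L)
  have h2 := continuousOn_gaussMap.comp h1 fun y hy => hy
  refine ((ℝ ∙ e)ᗮ.orthogonalProjectionOnto).continuous.comp_continuousOn ?_
  refine ContinuousOn.smul (ContinuousOn.inv₀ (h1.inner h2) fun y hy => ?_) h2
  exact (inner_pos_of_isOuterNormal h0 (isOuterNormal_gaussMap hy)).ne'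

/-- The preimage of the regular points is dense, so its tangent cone is everything, and the
derivative of the chart maps onto N^⊥. This makes derivatives within `reg L` unique on the tangent
space. -/
theorem orthogonal_gaussMap_subset_tangentConeAt (hL : Convex ℝ L) (hc : IsClosed L)
    (h0 : L ∈ 𝓝 (0 : F)) (hb : Bornology.IsBounded L) (he : ‖e‖ = 1) {y : (ℝ ∙ e)ᗮ}
    (hf : DifferentiableAt ℝ (fun y : (ℝ ∙ e)ᗮ => gauge L (e + (y : F))) y)
    (hR : Dense (boundaryChart L e ⁻¹' reg L)) :
    ((ℝ ∙ gaussMap L (boundaryChart L e y))ᗮ : Set F) ⊆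
      tangentConeAt ℝ (reg L) (boundaryChart L e y) := by
  intro η hη
  have hy := boundaryChart_mem_reg hL hc h0 hb he hf
  have hN := isOuterNormal_gaussMap hy
  have hg := gauge_pos_of_ne h0 hb (add_orthogonal_ne_zero he y)
  obtain ⟨B, hB, hBf⟩ := hasFDerivAt_boundaryChart hf.hasFDerivAt hg.ne'
  have hfP := fderiv_gauge_eq_inner_polarVector hL hc h0 hb he hf.hasFDerivAt hN
  have hPy := inner_gaussMap_polar_eq h0 hb he y hN
  have hηP : ⟪η, polarVector (boundaryChart L e y) (gaussMap L (boundaryChart L e y))⟫ = 0 := by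
    rw [polarVector, inner_smul_right, Submodule.mem_orthogonal_singleton_iff_inner_left.1 hη,
      mul_zero]
  set P := polarVector (boundaryChart L e y) (gaussMap L (boundaryChart L e y))
  set g := gauge L (e + (y : F))
  obtain ⟨a, ha, b, hb', rfl⟩ := (ℝ ∙ e).exists_add_mem_mem_orthogonal η
  obtain ⟨c, rfl⟩ := Submodule.mem_span_singleton.1 ha
  -- The preimage of η = c e + b under B, found by differentiating the inverse chart x ↦ x/⟨x,e⟩ - e
  -- in the direction η.
  have hcone : B (g • (⟨b, hb'⟩ - c • y)) ∈ tangentConeAt ℝ (reg L) (boundaryChart L e y) := by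
    refine tangentConeAt_mono (Set.image_preimage_subset _ _)
      (hB.hasFDerivWithinAt.mapsTo_tangent_cone ?_)
    rw [← tangentConeAt_closure, hR.closure_eq, tangentConeAt_univ]
    trivial
  convert hcone using 1
  rw [hBf, hfP]
  have hval : ⟪((g • (⟨b, hb'⟩ - c • y) : (ℝ ∙ e)ᗮ) : F), P⟫ = - (c * g ^ 2) := by
    rw [inner_add_left, inner_smul_left] at hηP
    rw [inner_add_left] at hPy
    simp only [Submodule.coe_smul, Submodule.coe_sub, inner_smul_left, inner_sub_left,
      conj_trivial] at hηP ⊢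
    have : ⟪(y : F), P⟫ = g - ⟪e, P⟫ := by linarith
    rw [this]
    linear_combination g * hηP
  rw [hval, show (g ^ 2)⁻¹ * (-(c * g ^ 2)) = -c by field_simp]
  simp only [Submodule.coe_smul, Submodule.coe_sub]
  rw [inv_smul_smul₀ hg.ne']
  module

/-- The curvature exists at `x`, and the regular boundary points approach `x` from every tangent
direction. -/
def RegularCurvatureAt (L : Set F) (x : F) : Prop :=
  CurvatureExistsAt L x ∧ ((ℝ ∙ gaussMap L x)ᗮ : Set F) ⊆ tangentConeAt ℝ (reg L) x

variable [MeasurableSpace F] [BorelSpace F]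

theorem ae_regularCurvatureAt_boundaryChart (hL : Convex ℝ L) (hc : IsClosed L)
    (h0 : L ∈ 𝓝 (0 : F)) (hb : Bornology.IsBounded L) (he : ‖e‖ = 1) :
    ∀ᵐ y ∂(μH[finrank ℝ (ℝ ∙ e)ᗮ] : Measure (ℝ ∙ e)ᗮ),
      RegularCurvatureAt L (boundaryChart L e y) := by
  obtain ⟨C, hC⟩ := hL.lipschitz_gauge h0
  have hlip : LipschitzWith C (fun y : (ℝ ∙ e)ᗮ => gauge L (e + (y : F))) :=
    LipschitzWith.of_dist_le_mul fun y y' => by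
      have := hC.dist_le_mul (e + (y : F)) (e + (y' : F))
      rwa [dist_add_left] at this
  have hdiff := hlip.ae_differentiableAt (μ := (μH[finrank ℝ (ℝ ∙ e)ᗮ] : Measure (ℝ ∙ e)ᗮ))
  have hreg : ∀ᵐ y ∂(μH[finrank ℝ (ℝ ∙ e)ᗮ] : Measure (ℝ ∙ e)ᗮ), boundaryChart L e y ∈ reg L :=
    hdiff.mono fun y hy => boundaryChart_mem_reg hL hc h0 hb he hy
  have hdense : Dense (boundaryChart L e ⁻¹' reg L) := dense_of_ae hreg
  have hT := ae_differentiableWithinAt_of_monotone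
    (fun y hy y' hy' => inner_gaugeGradient_sub_nonneg hL hc h0 hb he hy hy')
    (continuousOn_gaugeGradient hL h0 hb he)
  filter_upwards [hdiff, hreg, hT] with y h1 h2 h3
  exact ⟨⟨h2, differentiableWithinAt_gaussMap hL h0 hb he h2 (h3 h2)⟩,
    orthogonal_gaussMap_subset_tangentConeAt hL hc h0 hb he h1 hdense⟩

theorem ae_regularCurvatureAt_of_mem_nhds_zero {n : ℕ} (hn : finrank ℝ F = n + 1)
    (hL : Convex ℝ L) (hc : IsClosed L) (h0 : L ∈ 𝓝 (0 : F)) (hb : Bornology.IsBounded L) :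
    (μH[n] : Measure F) {x | x ∈ frontier L ∧ ¬ RegularCurvatureAt L x} = 0 := by
  have key : ∀ e : F, ‖e‖ = 1 → (μH[n] : Measure F)
      {x | (x ∈ frontier L ∧ ¬ RegularCurvatureAt L x) ∧ 0 < ⟪x, e⟫} = 0 := by
    intro e he
    have h1 := ae_regularCurvatureAt_boundaryChart hL hc h0 hb he
    have : Fact (finrank ℝ F = n + 1) := ⟨hn⟩
    rw [Submodule.finrank_orthogonal_span_singleton (n := n) (by rintro rfl; simp at he), ae_iff] at h1
    obtain ⟨C, hC⟩ := exists_lipschitzWith_boundaryChart hL h0 hb he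
    have h2 := hC.hausdorffMeasure_image_le (d := n) (by positivity)
      {y | ¬ RegularCurvatureAt L (boundaryChart L e y)}
    rw [h1, mul_zero] at h2
    refine measure_mono_null (fun x hx => ?_) (le_antisymm h2 zero_le)
    have h3 := boundaryChart_boundaryCoord hL h0 he hx.1.1 hx.2
    exact ⟨boundaryCoord e x, by rw [Set.mem_ofPred_eq, h3]; exact hx.1.2, h3⟩
  set b := stdOrthonormalBasis ℝ F
  -- A boundary point is not the origin, so one of its coordinates is non-zero; finitely many
  -- charts, centred at ± the basis vectors, suffice.
  have hcov : {x | x ∈ frontier L ∧ ¬ RegularCurvatureAt L x} ⊆ ⋃ i,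
      ({x | (x ∈ frontier L ∧ ¬ RegularCurvatureAt L x) ∧ 0 < ⟪x, b i⟫} ∪
        {x | (x ∈ frontier L ∧ ¬ RegularCurvatureAt L x) ∧ 0 < ⟪x, -b i⟫}) := by
    intro x hx
    by_contra hcon
    have hcon' : ∀ i, ⟪x, b i⟫ = 0 := fun i => by
      refine le_antisymm (not_lt.1 fun h => hcon ?_) (not_lt.1 fun h => hcon ?_)
      · exact Set.mem_iUnion.2 ⟨i, Or.inl ⟨hx, h⟩⟩
      · exact Set.mem_iUnion.2 ⟨i, Or.inr ⟨hx, by simpa using h⟩⟩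
    have hx0 : x = 0 := by
      rw [← b.sum_repr' x]
      exact Finset.sum_eq_zero fun i _ => by rw [real_inner_comm, hcon' i, zero_smul]
    exact hx.1.2 (hx0 ▸ mem_interior_iff_mem_nhds.2 h0)
  refine measure_mono_null hcov (measure_iUnion_null fun i => measure_union_null ?_ ?_)
  · exact key _ (by simp)
  · exact key _ (by simp)

end Curvature

/-! ### Moving an interior point to the origin. -/

section Translation

open Measure Module Filter Topology

variable {F : Type*} [NormedAddCommGroup F] [InnerProductSpace ℝ F] {L : Set F}

theorem isOuterNormal_preimage_add {c x N : F} :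
    IsOuterNormal ((· + c) ⁻¹' L) x N ↔ IsOuterNormal L (x + c) N := by
  refine and_congr_right fun _ => ⟨fun h y hy => ?_, fun h y hy => ?_⟩
  · have := h (y - c) (by simpa using hy)
    rwa [sub_sub, add_comm c] at this
  · have := h (y + c) hy
    rwa [add_sub_add_right_eq_sub] at this

theorem gaussMap_preimage_add (c x : F) :
    gaussMap ((· + c) ⁻¹' L) x = gaussMap L (x + c) := by
  have : IsOuterNormal ((· + c) ⁻¹' L) x = IsOuterNormal L (x + c) :=
    funext fun N => propext isOuterNormal_preimage_add
  rw [gaussMap, gaussMap, this]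

theorem frontier_preimage_add {F : Type*} [NormedAddCommGroup F] (L : Set F) (c : F) :
    frontier ((· + c) ⁻¹' L) = (· + c) ⁻¹' frontier L :=
  ((Homeomorph.addRight c).preimage_frontier L).symm

theorem reg_preimage_add (c : F) : reg ((· + c) ⁻¹' L) = (· + c) ⁻¹' reg L := by
  ext x
  simp only [reg, frontier_preimage_add, isOuterNormal_preimage_add]
  rfl

theorem RegularCurvatureAt.of_preimage_add {c x : F}
    (h : RegularCurvatureAt ((· + c) ⁻¹' L) x) : RegularCurvatureAt L (x + c) := by
  obtain ⟨⟨h1, h2⟩, h3⟩ := h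
  rw [reg_preimage_add] at h1 h2 h3
  rw [gaussMap_preimage_add] at h3
  refine ⟨⟨h1, ?_⟩, fun η hη => ?_⟩
  · have h4 : gaussMap L = fun z => gaussMap ((· + c) ⁻¹' L) (z - c) :=
      funext fun z => by rw [gaussMap_preimage_add, sub_add_cancel]
    rw [h4]
    have h5 : DifferentiableWithinAt ℝ (fun z : F => z - c) (reg L) (x + c) := by fun_prop
    rw [← add_sub_cancel_right x c] at h2
    exact DifferentiableWithinAt.comp (g := gaussMap ((· + c) ⁻¹' L)) (x + c) h2 h5 fun z hz => by simpa using hz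
  · have h4 : HasFDerivWithinAt (fun z : F => z + c) (ContinuousLinearMap.id ℝ F)
        ((· + c) ⁻¹' reg L) x := ((hasFDerivAt_id x).add_const c).hasFDerivWithinAt
    exact tangentConeAt_mono (Set.image_preimage_subset _ _) (h4.mapsTo_tangent_cone (h3 hη))

/-- Aleksandrov's theorem for the Gauss map of a convex body. -/
theorem hausdorffMeasure_not_regularCurvatureAt [FiniteDimensional ℝ F] [MeasurableSpace F]
    [BorelSpace F] {n : ℕ} (hn : finrank ℝ F = n + 1) (hL : Convex ℝ L) (hc : IsClosed L)
    (hi : (interior L).Nonempty) (hb : Bornology.IsBounded L) :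
    (μH[n] : Measure F) {x | x ∈ frontier L ∧ ¬ RegularCurvatureAt L x} = 0 := by
  obtain ⟨c, hcL⟩ := hi
  have hcont : Continuous (fun z : F => z + c) := by fun_prop
  have h0 : (· + c) ⁻¹' L ∈ 𝓝 (0 : F) :=
    hcont.continuousAt.preimage_mem_nhds (by simpa using mem_interior_iff_mem_nhds.1 hcL)
  have hb' : Bornology.IsBounded ((· + c) ⁻¹' L) := by
    have : (· + c) ⁻¹' L = (fun z => z - c) '' L := by
      ext z
      exact ⟨fun h => ⟨z + c, h, by simp⟩, by rintro ⟨w, hw, rfl⟩; simpa using hw⟩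
    rw [this]
    exact (LipschitzWith.id.sub (LipschitzWith.const c)).isBounded_image hb
  have h1 := ae_regularCurvatureAt_of_mem_nhds_zero hn (hL.translate_preimage_right c |> fun h => by
    simpa [add_comm] using h) (hc.preimage hcont) h0 hb'
  have h2 := (isometry_add_right c).lipschitz.hausdorffMeasure_image_le (d := n) (by positivity)
    {x | x ∈ frontier ((· + c) ⁻¹' L) ∧ ¬ RegularCurvatureAt ((· + c) ⁻¹' L) x}
  rw [h1, mul_zero] at h2
  refine measure_mono_null ?_ (le_antisymm h2 zero_le)
  intro x hx
  refine ⟨x - c, ⟨?_, fun h => hx.2 ?_⟩, sub_add_cancel x c⟩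
  · rw [frontier_preimage_add]
    simpa using hx.1
  · simpa using h.of_preimage_add

end Translation

/-! ### Gnomonic projection and the correspondence of normals. -/

section Gnomonic

open Measure Module Filter Topology

variable {E : Type*} [NormedAddCommGroup E] [InnerProductSpace ℝ E] {u : sphere (0 : E) 1}

theorem norm_coe_unitSphere {E : Type*} [NormedAddCommGroup E] (u : sphere (0 : E) 1) :
    ‖(u : E)‖ = 1 := norm_eq_of_mem_sphere u

theorem one_le_norm_add_orthogonal {e : E} (he : ‖e‖ = 1) (x : (ℝ ∙ e)ᗮ) :
    1 ≤ ‖e + (x : E)‖ := by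
  have := real_inner_le_norm (e + (x : E)) e
  rwa [inner_add_orthogonal he, he, mul_one] at this

/-- The inverse of the gnomonic projection. -/
def gnomonicInv (u : sphere (0 : E) 1) (x : (ℝ ∙ (u : E))ᗮ) : sphere (0 : E) 1 :=
  ⟨‖(u : E) + (x : E)‖⁻¹ • ((u : E) + (x : E)), by
    rw [mem_sphere_zero_iff_norm]
    exact norm_smul_inv_norm (𝕜 := ℝ) (add_orthogonal_ne_zero (norm_coe_unitSphere u) x)⟩

theorem coe_gnomonicInv (u : sphere (0 : E) 1) (x : (ℝ ∙ (u : E))ᗮ) :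
    (gnomonicInv u x : E) = ‖(u : E) + (x : E)‖⁻¹ • ((u : E) + (x : E)) := rfl

/-- Normalization is Lipschitz outside the open unit ball, and ‖u + x‖ ≥ 1. Only finiteness of the
constant matters, for transporting null sets to the sphere. -/
theorem lipschitzWith_gnomonicInv (u : sphere (0 : E) 1) : LipschitzWith 2 (gnomonicInv u) := by
  refine LipschitzWith.of_dist_le_mul fun x y => ?_
  have hx := one_le_norm_add_orthogonal (norm_coe_unitSphere u) x
  have hy := one_le_norm_add_orthogonal (norm_coe_unitSphere u) y
  have hd : dist x y = ‖((u : E) + (x : E)) - ((u : E) + (y : E))‖ := by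
    rw [add_sub_add_left_eq_sub, dist_eq_norm]; rfl
  rw [Subtype.dist_eq, coe_gnomonicInv, coe_gnomonicInv, hd, dist_eq_norm]
  generalize (u : E) + (x : E) = a at hx ⊢
  generalize (u : E) + (y : E) = b at hy ⊢
  have hb0 : ‖b‖ ≠ 0 := by linarith
  have ha0 : ‖a‖ ≠ 0 := by linarith
  have key : ‖a‖⁻¹ • a - ‖b‖⁻¹ • b = ‖a‖⁻¹ • ((a - b) + ((‖b‖ - ‖a‖) * ‖b‖⁻¹) • b) := by
    rw [sub_mul, mul_inv_cancel₀ hb0, sub_smul, one_smul, smul_add, smul_sub, smul_sub,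
      smul_smul, ← mul_assoc, inv_mul_cancel₀ ha0, one_mul]
    abel
  rw [key, norm_smul, norm_inv, norm_norm]
  calc ‖a‖⁻¹ * ‖(a - b) + ((‖b‖ - ‖a‖) * ‖b‖⁻¹) • b‖
      ≤ 1 * (‖a - b‖ + ‖a - b‖) := by
        gcongr
        · exact inv_le_one_of_one_le₀ hx
        · refine (norm_add_le _ _).trans ?_
          gcongr
          rw [norm_smul, norm_mul, norm_inv, norm_norm, mul_assoc, inv_mul_cancel₀ hb0, mul_one,
            Real.norm_eq_abs, abs_sub_comm]
          exact abs_norm_sub_norm_le a b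
    _ = (2 : NNReal) * ‖a - b‖ := by push_cast; ring

theorem inner_gnomonicInv_pos (u : sphere (0 : E) 1) (x : (ℝ ∙ (u : E))ᗮ) :
    0 < ⟪(u : E), (gnomonicInv u x : E)⟫ := by
  have hx := one_le_norm_add_orthogonal (norm_coe_unitSphere u) x
  rw [coe_gnomonicInv, inner_smul_right, real_inner_comm,
    inner_add_orthogonal (norm_coe_unitSphere u)]
  positivity

theorem gnomonicInv_gnomonic {v : sphere (0 : E) 1} (h : 0 < ⟪(u : E), (v : E)⟫) :
    gnomonicInv u (gnomonic u v) = v := by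
  apply Subtype.ext
  rw [coe_gnomonicInv, coe_gnomonic u v h.ne', add_sub_cancel, norm_smul, norm_coe_unitSphere,
    Real.norm_of_nonneg (by positivity), smul_smul]
  simp [h.ne']

theorem gnomonic_gnomonicInv (u : sphere (0 : E) 1) (x : (ℝ ∙ (u : E))ᗮ) :
    gnomonic u (gnomonicInv u x) = x := by
  have hx := one_le_norm_add_orthogonal (norm_coe_unitSphere u) x
  have hx0 : ‖(u : E) + (x : E)‖ ≠ 0 := by linarith
  apply Subtype.ext
  rw [coe_gnomonic u _ (inner_gnomonicInv_pos u x).ne', coe_gnomonicInv, inner_smul_right,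
    real_inner_comm, inner_add_orthogonal (norm_coe_unitSphere u), smul_smul]
  simp [hx0]

theorem gnomonic_eq_boundaryCoord (u v : sphere (0 : E) 1) :
    gnomonic u v = boundaryCoord (u : E) (v : E) := by
  rw [gnomonic, boundaryCoord, map_sub, real_inner_comm, sub_eq_self,
    Submodule.orthogonalProjectionOnto_eq_zero_iff]
  exact (ℝ ∙ (u : E)).le_orthogonal_orthogonal (Submodule.mem_span_singleton_self _)

theorem continuousOn_gnomonic (u : sphere (0 : E) 1) :
    ContinuousOn (gnomonic u) {v | 0 < ⟪(u : E), (v : E)⟫} := by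
  refine ((ℝ ∙ (u : E))ᗮ.orthogonalProjectionOnto).continuous.comp_continuousOn ?_
  refine ContinuousOn.sub (ContinuousOn.smul (ContinuousOn.inv₀ ?_ fun v hv => hv.ne') ?_)
    continuousOn_const <;> fun_prop

theorem isOpen_openHemisphere (u : sphere (0 : E) 1) :
    IsOpen {v : sphere (0 : E) 1 | 0 < ⟪(u : E), (v : E)⟫} :=
  isOpen_lt continuous_const (by fun_prop)

theorem isOpenMap_gnomonicInv (u : sphere (0 : E) 1) : IsOpenMap (gnomonicInv u) := by
  intro U hU
  have : gnomonicInv u '' U = {v : sphere (0 : E) 1 | 0 < ⟪(u : E), (v : E)⟫} ∩ gnomonic u ⁻¹' U := by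
    ext v
    constructor
    · rintro ⟨x, hx, rfl⟩
      exact ⟨inner_gnomonicInv_pos u x, by rwa [Set.mem_preimage, gnomonic_gnomonicInv]⟩
    · rintro ⟨hv, hvU⟩
      exact ⟨_, hvU, gnomonicInv_gnomonic hv⟩
  rw [this]
  exact (continuousOn_gnomonic u).isOpen_inter_preimage (isOpen_openHemisphere u) hU

/-- If u · v = 0, the arc leaving v in the direction -u exits the closed hemisphere at once, so v is
not interior. -/
theorem inner_pos_of_mem_interior {v : sphere (0 : E) 1}
    (hv : v ∈ interior (closedHemisphere u)) : 0 < ⟪(u : E), (v : E)⟫ := by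
  have hsub : ∀ w ∈ interior (closedHemisphere u), 0 ≤ ⟪(u : E), (w : E)⟫ :=
    fun w hw => interior_subset (s := closedHemisphere u) hw
  refine lt_of_le_of_ne (hsub v hv) fun h => ?_
  have huv : -(u : E) ∈ (ℝ ∙ (v : E))ᗮ := by
    rw [Submodule.mem_orthogonal_singleton_iff_inner_left, inner_neg_left, ← h, neg_zero]
  have hcont : Continuous fun t : ℝ => gnomonicInv v (t • ⟨-(u : E), huv⟩) :=
    (lipschitzWith_gnomonicInv v).continuous.comp (by fun_prop)
  have h0 : gnomonicInv v ((0 : ℝ) • ⟨-(u : E), huv⟩) = v := by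
    apply Subtype.ext
    simp [coe_gnomonicInv]
  have hev : ∀ᶠ t in 𝓝 (0 : ℝ),
      gnomonicInv v (t • ⟨-(u : E), huv⟩) ∈ interior (closedHemisphere u) :=
    hcont.continuousAt.eventually_mem (by rw [h0]; exact isOpen_interior.mem_nhds hv)
  obtain ⟨t, ht, htpos⟩ :=
    ((hev.filter_mono nhdsWithin_le_nhds).and (self_mem_nhdsWithin (s := Set.Ioi (0 : ℝ)))).exists
  have h1 : 0 ≤ ⟪(u : E), (gnomonicInv v (t • ⟨-(u : E), huv⟩) : E)⟫ := hsub _ ht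
  have h2 := one_le_norm_add_orthogonal (norm_coe_unitSphere v) (t • ⟨-(u : E), huv⟩)
  rw [coe_gnomonicInv, inner_smul_right, mul_nonneg_iff_of_pos_left (by positivity),
    inner_add_right, ← h] at h1
  simp [inner_smul_right] at h1
  exact absurd htpos (not_lt.2 h1)

variable {K : Set (sphere (0 : E) 1)}

theorem gnomonic_image_eq_preimage (hu : ∀ v ∈ K, 0 < ⟪(u : E), (v : E)⟫) :
    gnomonic u '' K = gnomonicInv u ⁻¹' K := by
  ext x
  constructor
  · rintro ⟨v, hv, rfl⟩
    rwa [Set.mem_preimage, gnomonicInv_gnomonic (hu v hv)]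
  · exact fun hx => ⟨_, hx, gnomonic_gnomonicInv u x⟩

theorem frontier_gnomonicInv_preimage (u : sphere (0 : E) 1) (K : Set (sphere (0 : E) 1)) :
    frontier (gnomonicInv u ⁻¹' K) = gnomonicInv u ⁻¹' frontier K :=
  ((isOpenMap_gnomonicInv u).preimage_frontier_eq_frontier_preimage
    (lipschitzWith_gnomonicInv u).continuous K).symm

theorem convex_gnomonicInv_preimage (hK : IsProperConvexBody K) (u : sphere (0 : E) 1) :
    Convex ℝ (gnomonicInv u ⁻¹' K) := by
  -- The projected body is the slice of the convex cone over K by the affine hyperplane through u.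
  have heq : gnomonicInv u ⁻¹' K =
      {x : (ℝ ∙ (u : E))ᗮ | (u : E) + (x : E) ∈ radialExtension K} := by
    ext x
    have hx := one_le_norm_add_orthogonal (norm_coe_unitSphere u) x
    constructor
    · intro h
      refine ⟨‖(u : E) + (x : E)‖, norm_nonneg _, _, h, ?_⟩
      rw [coe_gnomonicInv, smul_inv_smul₀ (by linarith)]
    · rintro ⟨r, hr, v, hv, h⟩
      have hr' : ‖(u : E) + (x : E)‖ = r := by
        rw [h, norm_smul, norm_coe_unitSphere, Real.norm_of_nonneg hr, mul_one]
      have : gnomonicInv u x = v := by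
        apply Subtype.ext
        rw [coe_gnomonicInv, hr', h, inv_smul_smul₀ (by linarith)]
      rwa [Set.mem_preimage, this]
  rw [heq]
  intro x hx y hy a b ha hb hab
  have := hK.convex hx hy ha hb hab
  rw [Set.mem_ofPred_eq]
  convert this using 1
  rw [Submodule.coe_add, Submodule.coe_smul, Submodule.coe_smul, smul_add, smul_add,
    add_add_add_comm, ← add_smul, hab, one_smul]

/-- The outer normal of a spherical body that corresponds to the outer normal `N` of its gnomonic
projection at `x`. -/
def sphericalNormal (u : sphere (0 : E) 1) (x N : (ℝ ∙ (u : E))ᗮ) : E :=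
  (√(1 + ⟪x, N⟫ ^ 2))⁻¹ • ((N : E) - ⟪x, N⟫ • (u : E))

theorem norm_sub_smul_sq (N : (ℝ ∙ (u : E))ᗮ) (s : ℝ) :
    ‖(N : E) - s • (u : E)‖ ^ 2 = ‖N‖ ^ 2 + s ^ 2 := by
  rw [norm_sub_sq_real, inner_smul_right, inner_coe_orthogonal, norm_smul, norm_coe_unitSphere]
  simp

theorem norm_sphericalNormal {x N : (ℝ ∙ (u : E))ᗮ} (hN : ‖N‖ = 1) :
    ‖sphericalNormal u x N‖ = 1 := by
  have h : ‖(N : E) - ⟪x, N⟫ • (u : E)‖ = √(1 + ⟪x, N⟫ ^ 2) := by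
    rw [eq_comm, Real.sqrt_eq_iff_eq_sq (by positivity) (norm_nonneg _), norm_sub_smul_sq, hN,
      one_pow]
  rw [sphericalNormal, ← h]
  refine norm_smul_inv_norm (𝕜 := ℝ) fun h0 => ?_
  rw [h0, norm_zero, eq_comm, Real.sqrt_eq_zero (by positivity)] at h
  nlinarith [sq_nonneg ⟪x, N⟫]

theorem inner_add_sphericalNormal (x N y : (ℝ ∙ (u : E))ᗮ) :
    ⟪(u : E) + (y : E), sphericalNormal u x N⟫ =
      (√(1 + ⟪x, N⟫ ^ 2))⁻¹ * ⟪y - x, N⟫ := by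
  rw [sphericalNormal, inner_smul_right, inner_sub_right, inner_smul_right,
    inner_add_orthogonal (norm_coe_unitSphere u), inner_add_left, real_inner_comm (N : E) (u : E),
    inner_coe_orthogonal, inner_sub_left, ← Submodule.coe_inner]
  ring

theorem starProjection_sphericalNormal (x N : (ℝ ∙ (u : E))ᗮ) :
    (ℝ ∙ (u : E))ᗮ.starProjection (sphericalNormal u x N) = (√(1 + ⟪x, N⟫ ^ 2))⁻¹ • (N : E) := by
  have h1 : (ℝ ∙ (u : E))ᗮ.starProjection (u : E) = 0 := by
    rw [Submodule.starProjection_apply_eq_zero_iff]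
    exact (ℝ ∙ (u : E)).le_orthogonal_orthogonal (Submodule.mem_span_singleton_self _)
  rw [sphericalNormal, map_smul, map_sub, map_smul, h1, smul_zero, sub_zero,
    Submodule.starProjection_eq_self_iff.2 N.2]

theorem sphericalProj_sphericalNormal {x N : (ℝ ∙ (u : E))ᗮ} (hN : ‖N‖ = 1) :
    sphericalProj (ℝ ∙ (u : E))ᗮ (sphericalNormal u x N) = N := by
  have hs : 0 < √(1 + ⟪x, N⟫ ^ 2) := by positivity
  rw [sphericalProj, starProjection_sphericalNormal, norm_smul, Submodule.norm_coe, hN,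
    Real.norm_of_nonneg (by positivity), mul_one, inv_inv, smul_inv_smul₀ hs.ne']

theorem IsOuterNormal.sphericalNormal (hu : ∀ v ∈ K, 0 < ⟪(u : E), (v : E)⟫)
    {x N : (ℝ ∙ (u : E))ᗮ} (hN : IsOuterNormal (gnomonicInv u ⁻¹' K) x N) :
    IsSphericalOuterNormal K (gnomonicInv u x : E) (sphericalNormal u x N) := by
  refine ⟨norm_sphericalNormal hN.1, ?_, fun v hv => ?_⟩
  · rw [coe_gnomonicInv, inner_smul_left, inner_add_sphericalNormal]
    simp
  · have h := hN.2 (gnomonic u v) (by rwa [Set.mem_preimage, gnomonicInv_gnomonic (hu v hv)])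
    have h1 : (v : E) = gnomonicInv u (gnomonic u v) := by rw [gnomonicInv_gnomonic (hu v hv)]
    rw [h1, coe_gnomonicInv, inner_smul_left, inner_add_sphericalNormal, conj_trivial]
    exact mul_nonpos_of_nonneg_of_nonpos (by positivity)
      (mul_nonpos_of_nonneg_of_nonpos (by positivity) h)

/-- Let m be the projection of M to u^⊥. Orthogonality of M to w forces M = m - ⟨x,m⟩u, so m ≠ 0,
and m/‖m‖ is the Euclidean normal. -/
theorem IsSphericalOuterNormal.exists_isOuterNormal {x : (ℝ ∙ (u : E))ᗮ} {M : E}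
    (hM : IsSphericalOuterNormal K (gnomonicInv u x : E) M) :
    ∃ N, IsOuterNormal (gnomonicInv u ⁻¹' K) x N ∧ M = sphericalNormal u x N := by
  have hdec := (ℝ ∙ (u : E)).starProjection_add_starProjection_orthogonal M
  rw [Submodule.starProjection_unit_singleton ℝ (norm_coe_unitSphere u)] at hdec
  set m : (ℝ ∙ (u : E))ᗮ := (ℝ ∙ (u : E))ᗮ.orthogonalProjectionOnto M with hm
  change ⟪(u : E), M⟫ • (u : E) + (m : E) = M at hdec
  have hin : ∀ y : (ℝ ∙ (u : E))ᗮ, ⟪(u : E) + (y : E), M⟫ = ⟪(u : E), M⟫ + ⟪y, m⟫ := fun y => by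
    rw [inner_add_left, hm, Submodule.inner_orthogonalProjectionOnto_eq_of_mem_left]
  have hxM : ⟪(u : E), M⟫ = -⟪x, m⟫ := by
    have h := hM.2.1
    have hx := one_le_norm_add_orthogonal (norm_coe_unitSphere u) x
    rw [coe_gnomonicInv, inner_smul_left, hin, conj_trivial, mul_eq_zero] at h
    rcases h with h | h
    · exact absurd h (by positivity)
    · linarith
  have hMm : M = (m : E) - ⟪x, m⟫ • (u : E) := by
    rw [hxM] at hdec
    rw [← hdec]
    module
  have hnorm : ‖m‖ ^ 2 + ⟪x, m⟫ ^ 2 = 1 := by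
    rw [← norm_sub_smul_sq, ← hMm, hM.1, one_pow]
  have hm0 : m ≠ 0 := by
    intro h
    simp [h] at hnorm
  have hmpos : 0 < ‖m‖ := norm_pos_iff.2 hm0
  refine ⟨‖m‖⁻¹ • m, ⟨norm_smul_inv_norm (𝕜 := ℝ) hm0, fun y hy => ?_⟩, ?_⟩
  · have h := hM.2.2 _ hy
    have hy' := one_le_norm_add_orthogonal (norm_coe_unitSphere u) y
    rw [coe_gnomonicInv, inner_smul_left, hin, hxM, conj_trivial] at h
    have h' := nonpos_of_mul_nonpos_right h (by positivity)
    rw [inner_smul_right, inner_sub_left]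
    exact mul_nonpos_of_nonneg_of_nonpos (by positivity) (by linarith)
  -- Divide ‖m‖² + ⟨x,m⟩² = 1 by ‖m‖².
  · have hs : √(1 + ⟪x, ‖m‖⁻¹ • m⟫ ^ 2) = ‖m‖⁻¹ := by
      rw [Real.sqrt_eq_iff_eq_sq (by positivity) (by positivity), inner_smul_right]
      field_simp
      linarith
    rw [sphericalNormal, hs, inv_inv, inner_smul_right, Submodule.coe_smul, hMm, ← smul_smul,
      ← smul_sub, smul_inv_smul₀ hmpos.ne']

theorem existsUnique_isSphericalOuterNormal_iff (hu : ∀ v ∈ K, 0 < ⟪(u : E), (v : E)⟫)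
    (x : (ℝ ∙ (u : E))ᗮ) :
    (∃! M, IsSphericalOuterNormal K (gnomonicInv u x : E) M) ↔
      ∃! N, IsOuterNormal (gnomonicInv u ⁻¹' K) x N := by
  constructor
  · rintro ⟨M, hM, huniq⟩
    obtain ⟨N, hN, rfl⟩ := IsSphericalOuterNormal.exists_isOuterNormal hM
    refine ⟨N, hN, fun N' hN' => ?_⟩
    have := huniq _ (hN'.sphericalNormal hu)
    apply Subtype.ext
    rw [← sphericalProj_sphericalNormal (x := x) hN'.1, this, sphericalProj_sphericalNormal hN.1]
  · rintro ⟨N, hN, huniq⟩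
    refine ⟨_, hN.sphericalNormal hu, fun M hM => ?_⟩
    obtain ⟨N', hN', rfl⟩ := IsSphericalOuterNormal.exists_isOuterNormal hM
    rw [huniq N' hN']

theorem gnomonicInv_mem_sphericalReg_iff (hu : ∀ v ∈ K, 0 < ⟪(u : E), (v : E)⟫)
    (x : (ℝ ∙ (u : E))ᗮ) :
    (gnomonicInv u x : E) ∈ sphericalReg K ↔ x ∈ reg (gnomonicInv u ⁻¹' K) := by
  rw [reg, Set.mem_ofPred_eq, frontier_gnomonicInv_preimage,
    ← existsUnique_isSphericalOuterNormal_iff hu]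
  constructor
  · rintro ⟨w, hw, h⟩
    obtain rfl := Subtype.ext hw
    exact h
  · exact fun h => ⟨_, rfl, h⟩

theorem sphericalGaussMap_gnomonicInv (hu : ∀ v ∈ K, 0 < ⟪(u : E), (v : E)⟫)
    {x : (ℝ ∙ (u : E))ᗮ} (hx : x ∈ reg (gnomonicInv u ⁻¹' K)) :
    sphericalGaussMap K (gnomonicInv u x : E) =
      sphericalNormal u x (gaussMap (gnomonicInv u ⁻¹' K) x) := by
  have h := (existsUnique_isSphericalOuterNormal_iff hu x).2 hx.2
  exact h.unique (Classical.epsilon_spec h.exists) ((isOuterNormal_gaussMap hx).sphericalNormal hu)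

theorem boundaryCoord_gnomonicInv (u : sphere (0 : E) 1) (x : (ℝ ∙ (u : E))ᗮ) :
    boundaryCoord (u : E) (gnomonicInv u x : E) = x := by
  rw [← gnomonic_eq_boundaryCoord, gnomonic_gnomonicInv]

theorem exists_eq_gnomonicInv_of_mem_sphericalReg (hK : IsClosed K)
    (hu : ∀ v ∈ K, 0 < ⟪(u : E), (v : E)⟫) {z : E} (hz : z ∈ sphericalReg K) :
    ∃ x ∈ reg (gnomonicInv u ⁻¹' K), z = gnomonicInv u x := by
  obtain ⟨w, rfl, hw, -⟩ := id hz
  have hpos := hu w (hK.frontier_subset hw)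
  refine ⟨gnomonic u w, ?_, by rw [gnomonicInv_gnomonic hpos]⟩
  rwa [← gnomonicInv_mem_sphericalReg_iff hu, gnomonicInv_gnomonic hpos]

end Gnomonic

/-! ### Linear algebra of the two Weingarten maps. -/

section Determinant

open Module

variable {E : Type*} [NormedAddCommGroup E] [InnerProductSpace ℝ E] [FiniteDimensional ℝ E]

theorem finrank_orthogonal_span_pair {n : ℕ} (hn : finrank ℝ E = n + 2) {w M : E}
    (h : LinearIndependent ℝ ![w, M]) : finrank ℝ (Submodule.span ℝ {w, M})ᗮ = n := by
  have h1 := finrank_span_eq_card h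
  rw [Matrix.range_cons, Matrix.range_cons, Matrix.range_empty, Set.union_empty,
    Set.singleton_union, Fintype.card_fin] at h1
  have h2 := (Submodule.span ℝ {w, M}).finrank_add_finrank_orthogonal
  omega

/-- Comparison of the determinants of two Weingarten maps that are related by the differential of
the gnomonic projection. -/
theorem tangentialDet_span_pair_eq {n : ℕ} (hn : finrank ℝ E = n + 1) {u : E} (hu : ‖u‖ = 1)
    {x N : (ℝ ∙ u)ᗮ} (hN : ‖N‖ = 1) {w M : E} {ρ c : ℝ} (hρ : 0 < ρ) (hc : 0 < c)
    (hρx : ρ ^ 2 = 1 + ‖x‖ ^ 2) (hcx : c ^ 2 = 1 + ⟪x, N⟫ ^ 2)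
    (hw : w = ρ⁻¹ • (u + (x : E))) (hM : M = c⁻¹ • ((N : E) - ⟪x, N⟫ • u))
    {A : (ℝ ∙ u)ᗮ →L[ℝ] (ℝ ∙ u)ᗮ} (hA : ∀ ξ ∈ (ℝ ∙ N)ᗮ, A ξ ∈ (ℝ ∙ N)ᗮ) {S : E →L[ℝ] E}
    (hS : ∀ ξ ∈ (ℝ ∙ N)ᗮ,
      (Submodule.span ℝ {w, M})ᗮ.orthogonalProjectionOnto
        (S (ρ⁻¹ • (Submodule.span ℝ {w, M})ᗮ.starProjection (ξ : E))) =
      (Submodule.span ℝ {w, M})ᗮ.orthogonalProjectionOnto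
        (c⁻¹ • ((A ξ : E) - ⟪x, A ξ⟫ • u))) :
    tangentialDet (Submodule.span ℝ {w, M})ᗮ S =
      tangentialDet (ℝ ∙ N)ᗮ A * (ρ / c) ^ (n + 1) := by
  have huN : ⟪u, (N : E)⟫ = 0 := by rw [real_inner_comm, inner_coe_orthogonal]
  have hux : ⟪u, (x : E)⟫ = 0 := by rw [real_inner_comm, inner_coe_orthogonal]
  have huu : ⟪u, u⟫ = 1 := by rw [real_inner_self_eq_norm_sq, hu, one_pow]
  have hNN : ⟪(N : E), (N : E)⟫ = 1 := by
    rw [real_inner_self_eq_norm_sq, Submodule.norm_coe, hN, one_pow]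
  have hxN : ⟪(x : E), (N : E)⟫ = ⟪x, N⟫ := (Submodule.coe_inner _ _ _).symm
  have hN0 : N ≠ 0 := by rintro rfl; simp at hN
  obtain ⟨m, rfl⟩ : ∃ m, n = m + 1 := by
    have : 0 < finrank ℝ (ℝ ∙ u)ᗮ := finrank_pos_iff_exists_ne_zero.2 ⟨N, hN0⟩
    have h1 := (ℝ ∙ u).finrank_add_finrank_orthogonal
    rw [finrank_span_singleton (by rintro rfl; simp at hu), hn] at h1
    exact ⟨n - 1, by omega⟩
  -- Testing span {w, M} against u and N gives a non-singular 2×2 system. This yields both the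
  -- independence of w, M and the injectivity of the projection from T to T'.
  have hcomb : ∀ a b : ℝ, ⟪u, a • w + b • M⟫ = a * ρ⁻¹ - b * (c⁻¹ * ⟪x, N⟫) ∧
      ⟪(N : E), a • w + b • M⟫ = a * (ρ⁻¹ * ⟪x, N⟫) + b * c⁻¹ := fun a b => by
    rw [hw, hM]
    simp only [inner_add_right, inner_sub_right, inner_smul_right, huN, hux, huu, hNN,
      real_inner_comm (x : E) (N : E), hxN, real_inner_comm u (N : E)]
    constructor <;> ring
  have hzero : ∀ a b : ℝ, ⟪u, a • w + b • M⟫ = 0 → ⟪(N : E), a • w + b • M⟫ = 0 →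
      a = 0 ∧ b = 0 := by
    intro a b h1 h2
    rw [(hcomb a b).1] at h1
    rw [(hcomb a b).2] at h2
    have h3 : b * (c⁻¹ * c ^ 2) = 0 := by
      rw [hcx]
      linear_combination h2 - ⟪x, N⟫ * h1
    have hb : b = 0 := (mul_eq_zero.1 h3).resolve_right (by positivity)
    rw [hb, zero_mul, sub_zero] at h1
    exact ⟨(mul_eq_zero.1 h1).resolve_right (by positivity), hb⟩
  have hfinT' : finrank ℝ (Submodule.span ℝ {w, M})ᗮ = m := by
    refine finrank_orthogonal_span_pair hn (LinearIndependent.pair_iff.2 fun a b hab => ?_)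
    exact hzero a b (by rw [hab, inner_zero_right]) (by rw [hab, inner_zero_right])
  have hfinT : finrank ℝ (ℝ ∙ N)ᗮ = m := by
    have h1 := (ℝ ∙ u).finrank_add_finrank_orthogonal
    have h2 := (ℝ ∙ N).finrank_add_finrank_orthogonal
    rw [finrank_span_singleton (by rintro rfl; simp at hu), hn] at h1
    rw [finrank_span_singleton hN0] at h2
    omega
  set T := (ℝ ∙ N)ᗮ with hT
  set T' := (Submodule.span ℝ {w, M})ᗮ with hT'
  have hTN : ∀ t : T, ⟪((t : (ℝ ∙ u)ᗮ) : E), (N : E)⟫ = 0 := fun t => by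
    rw [← Submodule.coe_inner]
    exact Submodule.mem_orthogonal_singleton_iff_inner_left.1 t.2
  let R : T →ₗ[ℝ] T' := (T'.orthogonalProjectionOnto ∘L (ℝ ∙ u)ᗮ.subtypeL ∘L T.subtypeL :
    T →L[ℝ] T')
  have hRapp : ∀ t : T, R t = T'.orthogonalProjectionOnto ((t : (ℝ ∙ u)ᗮ) : E) := fun t => rfl
  have hRinj : Function.Injective R := by
    rw [injective_iff_map_eq_zero]
    intro t ht
    rw [hRapp, Submodule.orthogonalProjectionOnto_eq_zero_iff, hT',
      Submodule.orthogonal_orthogonal] at ht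
    obtain ⟨a, b, hab⟩ := Submodule.mem_span_pair.1 ht
    have := hzero a b (by rw [hab, real_inner_comm, inner_coe_orthogonal])
      (by rw [hab, real_inner_comm, hTN])
    rw [this.1, this.2, zero_smul, zero_smul, add_zero] at hab
    exact Subtype.ext (Subtype.ext hab.symm)
  let e : T ≃ₗ[ℝ] T' := LinearEquiv.ofInjectiveOfFinrankEq R hRinj (hfinT.trans hfinT'.symm)
  have heapp : ∀ t, e t = R t := fun t => rfl
  set xT : T := T.orthogonalProjectionOnto x with hxT
  have hxTcoe : (xT : (ℝ ∙ u)ᗮ) = x - ⟪x, N⟫ • N := by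
    have := (ℝ ∙ N).starProjection_add_starProjection_orthogonal x
    rw [Submodule.starProjection_unit_singleton ℝ hN, real_inner_comm] at this
    rw [eq_sub_iff_add_eq, add_comm]
    exact this
  have hxTinner : ∀ t : T, ⟪xT, t⟫ = ⟪x, (t : (ℝ ∙ u)ᗮ)⟫ := fun t =>
    Submodule.inner_orthogonalProjectionOnto_eq_of_mem_right _ _
  have hxTnorm : ⟪xT, xT⟫ = ρ ^ 2 - c ^ 2 := by
    rw [hxTinner, hxTcoe, inner_sub_right, inner_smul_right, real_inner_self_eq_norm_sq, hρx, hcx]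
    ring
  -- Indeed u + c⁻² xT = c⁻²ρ w - c⁻¹⟨x,N⟩ M lies in span {w, M}, by c² = 1 + ⟨x,N⟩².
  have hproj : T'.orthogonalProjectionOnto u = -((c ^ 2)⁻¹ • e xT) := by
    rw [heapp, hRapp, ← map_smul, eq_neg_iff_add_eq_zero, ← map_add,
      Submodule.orthogonalProjectionOnto_eq_zero_iff, hT', Submodule.orthogonal_orthogonal,
      Submodule.mem_span_pair]
    refine ⟨(c ^ 2)⁻¹ * ρ, -((c ^ 2)⁻¹ * ⟪x, N⟫ * c), ?_⟩
    rw [hw, hM, hxTcoe, smul_smul, smul_smul, Submodule.coe_sub, Submodule.coe_smul]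
    have h1 : (c ^ 2)⁻¹ * ρ * ρ⁻¹ = (c ^ 2)⁻¹ := by field_simp
    have h2 : -((c ^ 2)⁻¹ * ⟪x, N⟫ * c) * c⁻¹ = -((c ^ 2)⁻¹ * ⟪x, N⟫) := by field_simp
    have h3 : ((c ^ 2)⁻¹ * (1 + ⟪x, N⟫ ^ 2)) • u = u := by
      rw [← hcx, inv_mul_cancel₀ (by positivity), one_smul]
    rw [h1, h2]
    refine Eq.trans ?_ (congrArg (· + (c ^ 2)⁻¹ • ((x : E) - ⟪x, N⟫ • (N : E))) h3)
    module
  let A' : T →ₗ[ℝ] T := (T.orthogonalProjectionOnto ∘L A ∘L T.subtypeL : T →L[ℝ] T)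
  have hA' : ∀ t : T, ((A' t : T) : (ℝ ∙ u)ᗮ) = A t := fun t =>
    Submodule.starProjection_eq_self_iff.2 (hA t t.2)
  let S' : T' →ₗ[ℝ] T' := (T'.orthogonalProjectionOnto ∘L S ∘L T'.subtypeL : T' →L[ℝ] T')
  -- Substituting the projection of u into `hS` turns -⟨x, Aξ⟩u into the rank-one term c⁻²⟨xT,
  -- Aξ⟩xT.
  let X : T →ₗ[ℝ] T :=
    (ρ / c) • (LinearMap.transvection ((innerSL ℝ xT : T →L[ℝ] ℝ) : T →ₗ[ℝ] ℝ)
      ((c ^ 2)⁻¹ • xT) ∘ₗ A')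
  have hconj : S' = (e : T →ₗ[ℝ] T') ∘ₗ X ∘ₗ (e.symm : T' →ₗ[ℝ] T) := by
    rw [← LinearMap.comp_assoc, LinearEquiv.eq_comp_toLinearMap_symm]
    ext1 t
    have h := hS t t.2
    rw [map_smul, map_smul] at h
    have h1 : S' (e t) = T'.orthogonalProjectionOnto (S (T'.starProjection ((t : (ℝ ∙ u)ᗮ) : E))) :=
      rfl
    have h2 : T'.orthogonalProjectionOnto (((A t : (ℝ ∙ u)ᗮ) : E) - ⟪x, A t⟫ • u) =
        e (A' t + ⟪xT, A' t⟫ • (c ^ 2)⁻¹ • xT) := by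
      rw [map_sub, map_smul, hproj, map_add, map_smul, map_smul, hxTinner, hA', heapp (A' t), hRapp,
        hA', smul_neg, sub_neg_eq_add]
    have h3 : X t = (ρ / c) • (A' t + ⟪xT, A' t⟫ • (c ^ 2)⁻¹ • xT) := rfl
    rw [LinearMap.comp_apply, LinearMap.comp_apply, LinearEquiv.coe_coe, h3, map_smul, ← h2, h1,
      div_eq_mul_inv, ← smul_smul, ← map_smul (T'.orthogonalProjectionOnto) c⁻¹, ← h,
      smul_inv_smul₀ hρ.ne']
  have hdet : LinearMap.det S' = LinearMap.det X := by rw [hconj, LinearMap.det_conj]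
  change LinearMap.det S' = LinearMap.det A' * _
  rw [hdet, LinearMap.det_smul, hfinT, LinearMap.det_comp, LinearMap.transvection.det]
  have : ((innerSL ℝ xT : T →L[ℝ] ℝ) : T →ₗ[ℝ] ℝ) ((c ^ 2)⁻¹ • xT) = (c ^ 2)⁻¹ * ⟪xT, xT⟫ := by
    rw [map_smul]; rfl
  rw [this, hxTnorm]
  -- The determinant of the transvection, as ‖xT‖² = ρ² - c². With the scalar factor in dimension m
  -- = n - 1 the total exponent is m + 2 = n + 1.
  have h4 : 1 + (c ^ 2)⁻¹ * (ρ ^ 2 - c ^ 2) = (ρ / c) ^ 2 := by field_simp; ring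
  rw [h4]
  ring

/-- Differentiate ⟨f,f⟩ = 1 within s; uniqueness of the derivative is available only along the
tangent cone, hence the condition on ξ. -/
theorem inner_eq_zero_of_norm_eq_one {G H : Type*} [NormedAddCommGroup G] [NormedSpace ℝ G]
    [NormedAddCommGroup H] [InnerProductSpace ℝ H] {f : G → H} {f' : G →L[ℝ] H} {s : Set G}
    {x ξ : G} (hf : HasFDerivWithinAt f f' s x) (h : ∀ z ∈ s, ‖f z‖ = 1) (hx : x ∈ s)
    (hξ : ξ ∈ tangentConeAt ℝ s x) : ⟪f' ξ, f x⟫ = 0 := by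
  have h1 := hf.inner ℝ hf
  have h2 : HasFDerivWithinAt (fun z => ⟪f z, f z⟫) (0 : G →L[ℝ] ℝ) s x :=
    (hasFDerivWithinAt_const (1 : ℝ) x s).congr
      (fun z hz => by rw [real_inner_self_eq_norm_sq, h z hz, one_pow])
      (by rw [real_inner_self_eq_norm_sq, h x hx, one_pow])
  have h3 := h1.unique_on h2 hξ
  simpa [real_inner_comm] using h3

end Determinant

/-! ### Differentiating the correspondence of normals. -/

section Weingarten

open Measure Module Filter Topology

variable {E : Type*} [NormedAddCommGroup E] [InnerProductSpace ℝ E] {u : sphere (0 : E) 1}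
  {K : Set (sphere (0 : E) 1)}

theorem differentiableAt_boundaryCoord {e x : E} (hx : ⟪x, e⟫ ≠ 0) :
    DifferentiableAt ℝ (boundaryCoord e) x :=
  ((ℝ ∙ e)ᗮ.orthogonalProjectionOnto).differentiableAt.comp x
    (((differentiableAt_id.inner ℝ (differentiableAt_const e)).inv hx).smul differentiableAt_id)

theorem DifferentiableWithinAt.inv_sqrt_one_add_sq {G : Type*} [NormedAddCommGroup G]
    [NormedSpace ℝ G] {f : G → ℝ} {s : Set G} {x : G} (hf : DifferentiableWithinAt ℝ f s x) :
    DifferentiableWithinAt ℝ (fun z => (√(1 + f z ^ 2))⁻¹) s x := by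
  have h1 : 1 + f x ^ 2 ≠ 0 := by positivity
  have h2 : √(1 + f x ^ 2) ≠ 0 := by positivity
  exact (((hf.pow 2).const_add 1).sqrt h1).inv h2

theorem SphericalCurvatureExistsAt.of_gnomonicInv (hK : IsClosed K)
    (hu : ∀ v ∈ K, 0 < ⟪(u : E), (v : E)⟫) {x : (ℝ ∙ (u : E))ᗮ}
    (hx : CurvatureExistsAt (gnomonicInv u ⁻¹' K) x) :
    SphericalCurvatureExistsAt K (gnomonicInv u x : E) := by
  refine ⟨(gnomonicInv_mem_sphericalReg_iff hu x).2 hx.1, ?_⟩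
  set L := gnomonicInv u ⁻¹' K with hL
  set w : E := (gnomonicInv u x : E) with hw
  have hco : DifferentiableWithinAt ℝ (boundaryCoord (u : E)) (sphericalReg K) w := by
    refine (differentiableAt_boundaryCoord ?_).differentiableWithinAt
    rw [real_inner_comm]
    exact (inner_gnomonicInv_pos u x).ne'
  have hN : DifferentiableWithinAt ℝ (fun z => gaussMap L (boundaryCoord (u : E) z))
      (sphericalReg K) w := by
    have h := hx.2
    rw [← boundaryCoord_gnomonicInv u x] at h
    refine h.comp w hco fun z hz => ?_
    obtain ⟨y, hy, rfl⟩ := exists_eq_gnomonicInv_of_mem_sphericalReg hK hu hz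
    rwa [boundaryCoord_gnomonicInv]
  have hs := hco.inner ℝ hN
  have hN' := (ℝ ∙ (u : E))ᗮ.subtypeL.differentiableAt.comp_differentiableWithinAt w hN
  have hsq := DifferentiableWithinAt.inv_sqrt_one_add_sq hs
  have hall : DifferentiableWithinAt ℝ (fun z => sphericalNormal u (boundaryCoord (u : E) z)
      (gaussMap L (boundaryCoord (u : E) z))) (sphericalReg K) w :=
    hsq.smul (hN'.sub (hs.smul_const (u : E)))
  refine hall.congr (fun z hz => ?_) ?_
  · obtain ⟨y, hy, rfl⟩ := exists_eq_gnomonicInv_of_mem_sphericalReg hK hu hz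
    rw [boundaryCoord_gnomonicInv, sphericalGaussMap_gnomonicInv hu hy]
  · rw [hw, boundaryCoord_gnomonicInv, sphericalGaussMap_gnomonicInv hu hx.1]

/-- The coefficient μ need not be known: u + x is parallel to w, so its term dies on projection to
{w, M}^⊥. -/
theorem hasFDerivAt_gnomonicInv (u : sphere (0 : E) 1) (x : (ℝ ∙ (u : E))ᗮ) :
    ∃ B : (ℝ ∙ (u : E))ᗮ →L[ℝ] E, HasFDerivAt (fun z => (gnomonicInv u z : E)) B x ∧
      ∃ μ : (ℝ ∙ (u : E))ᗮ →L[ℝ] ℝ, ∀ ξ, B ξ =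
        ‖(u : E) + (x : E)‖⁻¹ • (ξ : E) + μ ξ • ((u : E) + (x : E)) := by
  have h1 : HasFDerivAt (fun y : (ℝ ∙ (u : E))ᗮ => (u : E) + (y : E)) (ℝ ∙ (u : E))ᗮ.subtypeL x :=
    ((ℝ ∙ (u : E))ᗮ.subtypeL.hasFDerivAt).const_add (u : E)
  have h0 := add_orthogonal_ne_zero (norm_coe_unitSphere u) x
  have h2 := ((h1.differentiableAt.norm ℝ h0).inv (norm_ne_zero_iff.2 h0)).hasFDerivAt
  exact ⟨_, h2.smul h1, _, fun ξ => rfl⟩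

/-- The derivative of the normalizing factor again enters only through a term parallel to the
normal, which the later projection removes. -/
theorem hasFDerivWithinAt_sphericalNormal {G : (ℝ ∙ (u : E))ᗮ → (ℝ ∙ (u : E))ᗮ}
    {A : (ℝ ∙ (u : E))ᗮ →L[ℝ] (ℝ ∙ (u : E))ᗮ} {s : Set (ℝ ∙ (u : E))ᗮ} {x : (ℝ ∙ (u : E))ᗮ}
    (hG : HasFDerivWithinAt G A s x) :
    ∃ D : (ℝ ∙ (u : E))ᗮ →L[ℝ] E,
      HasFDerivWithinAt (fun z => sphericalNormal u z (G z)) D s x ∧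
      ∃ μ : (ℝ ∙ (u : E))ᗮ →L[ℝ] ℝ, ∀ ξ, D ξ =
        (√(1 + ⟪x, G x⟫ ^ 2))⁻¹ • ((A ξ : E) - (⟪x, A ξ⟫ + ⟪ξ, G x⟫) • (u : E)) +
          μ ξ • ((G x : E) - ⟪x, G x⟫ • (u : E)) := by
  have hs := (hasFDerivWithinAt_id x s).inner ℝ hG
  have hG' := (ℝ ∙ (u : E))ᗮ.subtypeL.hasFDerivAt.comp_hasFDerivWithinAt x hG
  have hsq : DifferentiableWithinAt ℝ (fun z => (√(1 + ⟪z, G z⟫ ^ 2))⁻¹) s x :=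
    DifferentiableWithinAt.inv_sqrt_one_add_sq hs.differentiableWithinAt
  refine ⟨_, hsq.hasFDerivWithinAt.smul (hG'.sub (hs.smul_const (u : E))),
    fderivWithin ℝ (fun z => (√(1 + ⟪z, G z⟫ ^ 2))⁻¹) s x, fun ξ => ?_⟩
  simp

theorem sphericalGaussKronecker_gnomonicInv [FiniteDimensional ℝ E] {n : ℕ}
    (hn : finrank ℝ E = n + 1) (hK : IsClosed K)
    (hu : ∀ v ∈ K, 0 < ⟪(u : E), (v : E)⟫) {x : (ℝ ∙ (u : E))ᗮ}
    (hx : RegularCurvatureAt (gnomonicInv u ⁻¹' K) x) :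
    sphericalGaussKronecker K (gnomonicInv u x : E) =
      gaussKronecker (gnomonicInv u ⁻¹' K) x *
        (‖(u : E) + (x : E)‖ / √(1 + ⟪x, gaussMap (gnomonicInv u ⁻¹' K) x⟫ ^ 2)) ^ (n + 1) := by
  have hsph := SphericalCurvatureExistsAt.of_gnomonicInv hK hu hx.1
  obtain ⟨⟨hreg, hdiff⟩, htan⟩ := hx
  have hMeq := sphericalGaussMap_gnomonicInv hu hreg
  have hNnorm := norm_gaussMap hreg
  have hA := hdiff.hasFDerivWithinAt
  have hS := hsph.2.hasFDerivWithinAt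
  obtain ⟨B, hB, μ, hBμ⟩ := hasFDerivAt_gnomonicInv u x
  obtain ⟨D, hD, ν, hDν⟩ := hasFDerivWithinAt_sphericalNormal hA
  change tangentialDet
    (Submodule.span ℝ {(gnomonicInv u x : E), sphericalGaussMap K (gnomonicInv u x : E)})ᗮ
    (fderivWithin ℝ (sphericalGaussMap K) (sphericalReg K) (gnomonicInv u x : E)) = _
  rw [gaussKronecker, hMeq]
  set L := gnomonicInv u ⁻¹' K with hL
  set N := gaussMap L x with hN
  set A := fderivWithin ℝ (gaussMap L) (reg L) x
  set S := fderivWithin ℝ (sphericalGaussMap K) (sphericalReg K) (gnomonicInv u x : E)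
  have hρ := one_le_norm_add_orthogonal (norm_coe_unitSphere u) x
  have hAN : ∀ ξ ∈ (ℝ ∙ N)ᗮ, A ξ ∈ (ℝ ∙ N)ᗮ := fun ξ hξ => by
    rw [Submodule.mem_orthogonal_singleton_iff_inner_left]
    exact inner_eq_zero_of_norm_eq_one hA (fun z hz => norm_gaussMap hz) hreg (htan hξ)
  -- S ∘ B and D differentiate the same map on `reg L`; they are known to agree only along its
  -- tangent cone, which contains N^⊥.
  have hchain : ∀ ξ ∈ (ℝ ∙ N)ᗮ, S (B ξ) = D ξ := fun ξ hξ => by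
    have h1 : HasFDerivWithinAt (fun z => sphericalGaussMap K (gnomonicInv u z : E)) (S ∘L B)
        (reg L) x := HasFDerivWithinAt.comp (g := sphericalGaussMap K) x hS hB.hasFDerivWithinAt fun z hz =>
      (gnomonicInv_mem_sphericalReg_iff hu z).2 hz
    have h2 := hD.congr (fun z hz => sphericalGaussMap_gnomonicInv hu hz) hMeq
    exact h1.unique_on h2 (htan hξ)
  have hBw : ∀ ξ, ⟪B ξ, (gnomonicInv u x : E)⟫ = 0 := fun ξ =>
    inner_eq_zero_of_norm_eq_one hB.hasFDerivWithinAt (fun z _ => norm_coe_unitSphere _)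
      (Set.mem_univ x) (by rw [tangentConeAt_univ]; trivial)
  have hxM : ⟪(u : E) + (x : E), sphericalNormal u x N⟫ = 0 := by
    rw [inner_add_sphericalNormal]
    simp
  refine tangentialDet_span_pair_eq (w := (gnomonicInv u x : E)) (M := sphericalNormal u x N) hn (norm_coe_unitSphere u) hNnorm (by linarith)
    (by positivity) ?_ (Real.sq_sqrt (by positivity)) rfl rfl hAN fun ξ hξ => ?_
  · have h := norm_add_sq_real (u : E) (x : E)
    rw [real_inner_comm, inner_coe_orthogonal, norm_coe_unitSphere] at h
    rw [h, Submodule.norm_coe]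
    ring
  · have hξN : ⟪ξ, N⟫ = 0 := Submodule.mem_orthogonal_singleton_iff_inner_left.1 hξ
    set w : E := (gnomonicInv u x : E) with hw
    set M := sphericalNormal u x N with hM
    set T' := (Submodule.span ℝ {w, M})ᗮ with hT'
    have hpw : (u : E) + (x : E) = ‖(u : E) + (x : E)‖ • w := by
      rw [hw, coe_gnomonicInv, smul_inv_smul₀ (by linarith)]
    have hpT : ∀ a : ℝ, T'.starProjection (a • ((u : E) + (x : E))) = 0 := fun a => by
      rw [Submodule.starProjection_apply_eq_zero_iff, hT', Submodule.orthogonal_orthogonal, hpw,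
        smul_smul]
      exact Submodule.smul_mem _ _ (Submodule.subset_span (by simp))
    have hmT : ∀ a : ℝ, T'.orthogonalProjectionOnto (a • ((N : E) - ⟪x, N⟫ • (u : E))) = 0 := by
      intro a
      have hmM : (N : E) - ⟪x, N⟫ • (u : E) = √(1 + ⟪x, N⟫ ^ 2) • M := by
        rw [hM, sphericalNormal, smul_inv_smul₀ (by positivity)]
      rw [Submodule.orthogonalProjectionOnto_eq_zero_iff, hT', Submodule.orthogonal_orthogonal,
        hmM, smul_smul]
      exact Submodule.smul_mem _ _ (Submodule.subset_span (by simp))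
    -- B ξ is tangent to the boundary of K, so it equals its own projection, namely ρ⁻¹ times that
    -- of ξ.
    have hBT : B ξ ∈ T' := by
      have hBM : ⟪B ξ, M⟫ = 0 := by
        have h1 : ⟪(ξ : E), M⟫ = 0 := by
          rw [hM, sphericalNormal, inner_smul_right, inner_sub_right, inner_smul_right,
            inner_coe_orthogonal, ← Submodule.coe_inner, hξN]
          simp
        rw [hBμ, inner_add_left, inner_smul_left, inner_smul_left, hxM, h1]
        simp
      rw [hT', Submodule.mem_orthogonal']
      intro z hz
      obtain ⟨a, b, rfl⟩ := Submodule.mem_span_pair.1 hz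
      rw [inner_add_right, inner_smul_right, inner_smul_right, hBw, hBM]
      simp
    have hBeq : ‖(u : E) + (x : E)‖⁻¹ • T'.starProjection (ξ : E) = B ξ := by
      rw [← Submodule.starProjection_eq_self_iff.2 hBT, hBμ, map_add, hpT, add_zero, map_smul]
    rw [hBeq, hchain ξ hξ, hDν, map_add, hmT, add_zero, hξN, add_zero]

end Weingarten

/-! ### The spherical support function and the cosines. -/

section Support

variable {E : Type*} [NormedAddCommGroup E] [InnerProductSpace ℝ E]
  {u : sphere (0 : E) 1} {K : Set (sphere (0 : E) 1)}

theorem cos_sphericalDist_gnomonicInv (x : (ℝ ∙ (u : E))ᗮ) :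
    Real.cos (sphericalDist (u : E) (gnomonicInv u x : E)) = ‖(u : E) + (x : E)‖⁻¹ := by
  have h := real_inner_le_norm (u : E) (gnomonicInv u x : E)
  rw [norm_coe_unitSphere, norm_coe_unitSphere, one_mul] at h
  rw [sphericalDist, Real.cos_arccos (by linarith [inner_gnomonicInv_pos u x]) h, coe_gnomonicInv,
    inner_smul_right, real_inner_comm, inner_add_orthogonal (norm_coe_unitSphere u), mul_one]

variable [FiniteDimensional ℝ E]

theorem sphericalProj_span_pair_gnomonicInv {N : (ℝ ∙ (u : E))ᗮ} (hN : ‖N‖ = 1)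
    (y : (ℝ ∙ (u : E))ᗮ) :
    sphericalProj (Submodule.span ℝ {(u : E), (N : E)}) (gnomonicInv u y : E) =
      (√(1 + ⟪y, N⟫ ^ 2))⁻¹ • ((u : E) + ⟪y, N⟫ • (N : E)) := by
  have hy := one_le_norm_add_orthogonal (norm_coe_unitSphere u) y
  have hproj : (Submodule.span ℝ {(u : E), (N : E)}).starProjection ((u : E) + (y : E)) =
      (u : E) + ⟪y, N⟫ • (N : E) := by
    refine Submodule.eq_starProjection_of_mem_orthogonal ?_ ?_
    · exact Submodule.mem_span_pair.2 ⟨1, ⟪y, N⟫, by rw [one_smul]⟩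
    · rw [Submodule.mem_orthogonal']
      intro z hz
      obtain ⟨a, b, rfl⟩ := Submodule.mem_span_pair.1 hz
      rw [add_sub_add_left_eq_sub]
      simp only [inner_add_right, inner_smul_right, inner_sub_left, inner_smul_left,
        inner_coe_orthogonal, ← Submodule.coe_inner, real_inner_self_eq_norm_sq, hN]
      simp
  have hnorm : ‖(u : E) + ⟪y, N⟫ • (N : E)‖ = √(1 + ⟪y, N⟫ ^ 2) := by
    rw [eq_comm, Real.sqrt_eq_iff_eq_sq (by positivity) (norm_nonneg _), norm_add_sq_real,
      inner_smul_right, real_inner_comm (N : E) (u : E), inner_coe_orthogonal, norm_smul, Submodule.norm_coe, hN,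
      norm_coe_unitSphere]
    simp
  rw [sphericalProj, coe_gnomonicInv, map_smul, hproj, norm_smul, hnorm, norm_inv, norm_norm,
    mul_inv, inv_inv, smul_smul]
  congr 1
  field_simp

/-- In the plane of u and N the projected point has direction u + tN with t = ⟨y,N⟩, at signed angle
arctan t from u. -/
theorem sign_mul_sphericalDist_gnomonicInv {N : (ℝ ∙ (u : E))ᗮ} (hN : ‖N‖ = 1)
    (y : (ℝ ∙ (u : E))ᗮ) :
    Real.sign ⟪(N : E), (gnomonicInv u y : E)⟫ * sphericalDist (u : E)
      (sphericalProj (Submodule.span ℝ {(u : E), (N : E)}) (gnomonicInv u y : E)) =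
      Real.arctan ⟪y, N⟫ := by
  have hy := one_le_norm_add_orthogonal (norm_coe_unitSphere u) y
  have hypos : 0 < ‖(u : E) + (y : E)‖⁻¹ := by positivity
  have h1 : ⟪(N : E), (gnomonicInv u y : E)⟫ = ‖(u : E) + (y : E)‖⁻¹ * ⟪y, N⟫ := by
    rw [coe_gnomonicInv, inner_smul_right, inner_add_right, inner_coe_orthogonal, zero_add,
      real_inner_comm, ← Submodule.coe_inner]
  have h2 : sphericalDist (u : E)
      (sphericalProj (Submodule.span ℝ {(u : E), (N : E)}) (gnomonicInv u y : E)) =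
      Real.arccos (√(1 + ⟪y, N⟫ ^ 2))⁻¹ := by
    rw [sphericalDist, sphericalProj_span_pair_gnomonicInv hN, inner_smul_right, inner_add_right,
      inner_smul_right, real_inner_comm (N : E), inner_coe_orthogonal, real_inner_self_eq_norm_sq,
      norm_coe_unitSphere]
    simp
  rw [h1, h2]
  generalize ⟪y, N⟫ = t
  rcases lt_trichotomy t 0 with ht | rfl | ht
  · rw [Real.sign_of_neg (mul_neg_of_pos_of_neg hypos ht), ← neg_sq t,
      ← Real.arctan_eq_arccos (by linarith), Real.arctan_neg]
    ring
  · simp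
  · rw [Real.sign_of_pos (by positivity), ← Real.arctan_eq_arccos ht.le, one_mul]

/-- Since arctan is increasing, the maximum over K is attained where ⟨·,N⟩ is maximal on the
projected body, that is, at x. -/
theorem sphericalSupport_eq_arctan (hu : ∀ v ∈ K, 0 < ⟪(u : E), (v : E)⟫)
    {x N : (ℝ ∙ (u : E))ᗮ} (hx : gnomonicInv u x ∈ K)
    (hN : IsOuterNormal (gnomonicInv u ⁻¹' K) x N) :
    sphericalSupport u K (N : E) = Real.arctan ⟪x, N⟫ := by
  refine IsGreatest.csSup_eq ⟨⟨_, hx, sign_mul_sphericalDist_gnomonicInv hN.1 x⟩, ?_⟩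
  rintro _ ⟨v, hv, rfl⟩
  have hv' := gnomonicInv_gnomonic (hu v hv)
  have h := hN.2 (gnomonic u v) (by rwa [Set.mem_preimage, hv'])
  have h2 := sign_mul_sphericalDist_gnomonicInv hN.1 (gnomonic u v)
  rw [hv'] at h2
  simp only [h2]
  rw [inner_sub_left] at h
  exact Real.arctan_mono (by linarith)

end Support

end SphericalConvex

end

/-! ### The curvature formula. -/

theorem lemma4p4 (n : ℕ) (hn : 2 ≤ n)
    (K : Set (sphere (0 : EuclideanSpace ℝ (Fin (n + 1))) 1))
    (hK : SphericalConvex.IsProperConvexBody K) (hint : (interior K).Nonempty)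
    (u : sphere (0 : EuclideanSpace ℝ (Fin (n + 1))) 1)
    (hu : K ⊆ interior (SphericalConvex.closedHemisphere u)) :
    ∀ᵐ w : sphere (0 : EuclideanSpace ℝ (Fin (n + 1))) 1
        ∂((Measure.hausdorffMeasure ((n : ℝ) - 1)).restrict (frontier K)),
      SphericalConvex.SphericalCurvatureExistsAt K (w : EuclideanSpace ℝ (Fin (n + 1))) ∧
      SphericalConvex.CurvatureExistsAt (SphericalConvex.gnomonic u '' K)
        (SphericalConvex.gnomonic u w) ∧
      SphericalConvex.sphericalGaussKronecker K (w : EuclideanSpace ℝ (Fin (n + 1))) =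
        SphericalConvex.gaussKronecker (SphericalConvex.gnomonic u '' K)
            (SphericalConvex.gnomonic u w) *
          (Real.cos (SphericalConvex.sphericalSupport u K
              (SphericalConvex.sphericalProj
                (ℝ ∙ (u : EuclideanSpace ℝ (Fin (n + 1))))ᗮ
                (SphericalConvex.sphericalGaussMap K (w : EuclideanSpace ℝ (Fin (n + 1)))))) /
            Real.cos (SphericalConvex.sphericalDist
              (u : EuclideanSpace ℝ (Fin (n + 1))) (w : EuclideanSpace ℝ (Fin (n + 1))))) ^
            (n + 1) := by
  have hpos : ∀ v ∈ K, 0 < ⟪(u : EuclideanSpace ℝ (Fin (n + 1))), v⟫ :=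
    fun v hv => SphericalConvex.inner_pos_of_mem_interior (hu hv)
  have hfin : Module.finrank ℝ (EuclideanSpace ℝ (Fin (n + 1))) = n + 1 := by simp
  have hfinV : Module.finrank ℝ (ℝ ∙ (u : EuclideanSpace ℝ (Fin (n + 1))))ᗮ = n - 1 + 1 := by
    have : Fact (Module.finrank ℝ (EuclideanSpace ℝ (Fin (n + 1))) = n + 1) := ⟨hfin⟩
    rw [Submodule.finrank_orthogonal_span_singleton (n := n) (ne_zero_of_mem_unit_sphere u)]
    omega
  have hcast : ((n - 1 : ℕ) : ℝ) = (n : ℝ) - 1 := by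
    rw [Nat.cast_sub (by omega), Nat.cast_one]
  set L := SphericalConvex.gnomonicInv u ⁻¹' K with hL
  have himage : SphericalConvex.gnomonic u '' K = L :=
    SphericalConvex.gnomonic_image_eq_preimage hpos
  have hlip := SphericalConvex.lipschitzWith_gnomonicInv u
  have hint' : (interior L).Nonempty := by
    obtain ⟨v, hv⟩ := hint
    refine ⟨SphericalConvex.gnomonic u v,
      preimage_interior_subset_interior_preimage hlip.continuous ?_⟩
    rwa [Set.mem_preimage, SphericalConvex.gnomonicInv_gnomonic (hpos v (interior_subset hv))]
  -- K is compact inside the open hemisphere, where the gnomonic projection is continuous.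
  have hbdd : Bornology.IsBounded L := by
    rw [← himage]
    exact (hK.isClosed.isCompact.image_of_continuousOn
      ((SphericalConvex.continuousOn_gnomonic u).mono hpos)).isBounded
  have hnull := SphericalConvex.hausdorffMeasure_not_regularCurvatureAt hfinV
    (SphericalConvex.convex_gnomonicInv_preimage hK u) (hK.isClosed.preimage hlip.continuous)
    hint' hbdd
  -- The Lipschitz inverse projection carries the exceptional null set of L to a null set on the
  -- sphere.
  have himg := hlip.hausdorffMeasure_image_le (d := ((n - 1 : ℕ) : ℝ)) (by positivity)
    {x | x ∈ frontier L ∧ ¬ SphericalConvex.RegularCurvatureAt L x}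
  rw [hnull, mul_zero, hcast] at himg
  rw [ae_restrict_iff' isClosed_frontier.measurableSet]
  filter_upwards [measure_eq_zero_iff_ae_notMem.1 (le_antisymm himg zero_le)] with w hw hwK
  have hwpos := hpos w (hK.isClosed.frontier_subset hwK)
  obtain ⟨x, rfl⟩ : ∃ x, SphericalConvex.gnomonicInv u x = w :=
    ⟨_, SphericalConvex.gnomonicInv_gnomonic hwpos⟩
  have hx : SphericalConvex.RegularCurvatureAt L x := by
    by_contra hcon
    refine hw ⟨x, ⟨?_, hcon⟩, rfl⟩
    rwa [hL, SphericalConvex.frontier_gnomonicInv_preimage]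
  have hN := SphericalConvex.isOuterNormal_gaussMap hx.1.1
  rw [himage, SphericalConvex.gnomonic_gnomonicInv]
  refine ⟨SphericalConvex.SphericalCurvatureExistsAt.of_gnomonicInv hK.isClosed hpos hx.1, hx.1, ?_⟩
  rw [SphericalConvex.sphericalGaussKronecker_gnomonicInv hfin hK.isClosed hpos hx,
    SphericalConvex.sphericalGaussMap_gnomonicInv hpos hx.1.1,
    SphericalConvex.sphericalProj_sphericalNormal hN.1,
    SphericalConvex.sphericalSupport_eq_arctan hpos (hK.isClosed.frontier_subset hwK) hN,
    SphericalConvex.cos_sphericalDist_gnomonicInv, Real.cos_arctan]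
  congr 2
  rw [div_inv_eq_mul, one_div, mul_comm, div_eq_mul_inv]
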